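/- **Setting.** Consider the nonlinear second-order cone program $$\min_{x\in\mathbb R^n} f(x)\quad\text{s.t.}\quad h(x)=0,\quad g^j(x)\in\mathcal Q_j,\ j=1,\dots,J,$$ where $f:\mathbb R^n\to\mathbb R$, $h:\mathbb R^n\to\mathbb R^m$, $g^j:\mathbb R^n\to\mathbb R^{1+r_j}$ ($r_j\ge 0$) are twice continuously differentiable. Vectors of $\mathbb R^{1+r}$ are written $y=(\dot y;\bar y)$ with $\dot y\in\mathbb R$, $\bar y\in\mathbb R^{r}$, and $\mathcal Q_j=\{y\in\mathbb R^{1+r_j}\mid \dot y\ge\|\bar y\|\}$ (so $\mathcal Q_j=[0,\infty)$ if $r_j=0$). Let $G=(h,g^1,\dots,g^J)$, $\mathcal K=\{0\}\times\prod_j\mathcal Q_j$, and let $\mathcal L(x,\lambda,\mu)=f(x)-\langle\lambda,h(x)\rangle-\sum_j\langle\mu^j,g^j(x)\rangle$. $\mathcal J$ denotes Jacobians and $\nabla g^j=(\mathcal Jg^j)^\top$. For a closed convex set $\Omega$, $\mathcal N_\Omega$ is the normal cone mapping of convex analysis and $\mathcal T_\Omega$ is the tangent cone. For a set-valued mapping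 $\Psi$, $\mathcal D^*\Psi(u,v)(q)=\{p\mid(p,-q)\in\mathcal N_{\mathrm{gph}\,\Psi}(u,v)\}$ is the limiting coderivative, where $\mathcal N_{\mathrm{gph}\,\Psi}$ is the limiting (Mordukhovich) normal cone to the graph. Let $x^*$ be a locally optimal solution with an associated multiplier $(\lambda^*,\mu^*)$, i.e. $\nabla_x\mathcal L(x^*,\lambda^*,\mu^*)=0$ and $-(\mu^*)^j\in\mathcal N_{\mathcal Q_j}(g^j(x^*))$ for all $j$. Define $$\begin{aligned} J_3&=\{j\mid g^j(x^*),(\mu^*)^j\in\mathrm{bdry}\,\mathcal Q_j\setminus\{0\}\}, & J_4&=\{j\mid g^j(x^*)=0,\ (\mu^*)^j\in\mathrm{bdry}\,\mathcal Q_j\setminus\{0\}\},\\ J_5&=\{j\mid g^j(x^*)\in\mathrm{bdry}\,\mathcal Q_j\setminus\{0\},\ (\mu^*)^j=0\}, & J_6&=\{j\mid g^j(x^*)=0,\ (\mu^*)^j=0\}. \end{aligned}$$ Let $\mathcal C(x^*)=\{d\mid \mathcal JG(x^*)d\in\mathcal T_{\mathcal K}(G(x^*)),\ \langle\nabla f(x^*),d\rangle\le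 0\}$ be the critical cone, $\mathrm{aff}(\mathcal C(x^*))$ the smallest linear subspace containing it, and $$\Theta=\nabla^2_{xx}\mathcal L(x^*,\lambda^*,\mu^*)-\sum_{j\in J_3}\frac{(\dot\mu^*)^j}{\dot g^j(x^*)}\,\nabla g^j(x^*)\begin{pmatrix}1&0\\0&-I_{r_j}\end{pmatrix}\mathcal Jg^j(x^*).$$ Let $H\in\mathbb R^{n\times\ell}$ have full column rank with $\mathrm{rge}\,H=\mathrm{aff}(\mathcal C(x^*))$, and put $$\mathcal G_j=\begin{cases}((\dot\mu^*)^j;-(\bar\mu^*)^j)^\top\mathcal Jg^j(x^*)H,& j\in J_4,\\ (\dot g^j(x^*);-\bar g^j(x^*))^\top\mathcal Jg^j(x^*)H,& j\in J_5,\\ \mathcal Jg^j(x^*)H,& j\in J_6,\end{cases}$$ a matrix with $m_j$ rows and $\ell$ columns, where $m_j=1$ for $j\in J_4\cup J_5$ and $m_j=1+r_j$ for $j\in J_6$. Let $N=|J_4\cup J_5\cup J_6|$ and let $j_1,\dots,j_N$ enumerate $J_4\cup J_5\cup J_6$ without repetition, first $J_4$, then $J_5$, then $J_6$. **Proposition 4.7.**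 Assume: 1. (nondegeneracy) $\mathcal JG(x^*)\mathbb R^n+\mathrm{lin}\,\mathcal T_{\mathcal K}(G(x^*))=\mathbb R^m\times\prod_j\mathbb R^{1+r_j}$, where $\mathrm{lin}$ denotes the largest linear subspace contained in the cone; 2. (reduced coderivative condition) for every $\nu\in\mathbb R^\ell\setminus\{0\}$, $$H^\top\Theta H\nu\notin-\Big\{\sum_{j\in J_4\cup J_5\cup J_6}\mathcal G_j^\top p^j\ \Big|\ p^j\in\mathcal D^*\mathcal N_{[0,\infty)}(0,0)(\mathcal G_j\nu)\ (j\in J_4\cup J_5),\ \ p^j\in\mathcal D^*\mathcal N_{\mathcal Q_j}(0,0)(\mathcal G_j\nu)\ (j\in J_6)\Big\}.$$ Let $P_0=I_\ell$ and, for $i=1,\dots,N$, let $R_i$ be a matrix with $\ell-\sum_{k<i}m_{j_k}$ rows and $\ell-\sum_{k\le i}m_{j_k}$ columns such that $\mathrm{rge}\,R_i=\ker(\mathcal G_{j_i}P_{i-1})$, where $P_i=R_1R_2\cdots R_i$. Let $T_i=P_i^\top H^\top\Theta HP_i$ for $i=0,\dots,N$. Then every $T_i$, $i=0,1,\dots,N$,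 is nonsingular, and $$[\mathcal G_{j_i}P_{i-1}]\,T_{i-1}^{-1}\,[\mathcal G_{j_i}P_{i-1}]^\top\succ O\qquad\text{for all } i=1,\dots,N.$$ -/

import Mathlib

open Filter Topology
open scoped NNReal

noncomputable section

namespace NSOCP

/-! ### Variational analysis -/

section Variational

variable {E F : Type*} [NormedAddCommGroup E] [InnerProductSpace ℝ E]
  [NormedAddCommGroup F] [InnerProductSpace ℝ F]

/-- The normal cone of convex analysis to `Ω` at `u` (empty if `u ∉ Ω`). -/
def normalCone (Ω : Set E) (u : E) : Set E :=
  {p | u ∈ Ω ∧ ∀ u' ∈ Ω, inner ℝ p (u' - u) ≤ 0}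

/-- The regular (Fréchet) normal cone to `Ω` at `u` (empty if `u ∉ Ω`):
`⟨p, u' - u⟩ ≤ o(‖u' - u‖)` for `u' ∈ Ω`. -/
def regularNormalCone (Ω : Set E) (u : E) : Set E :=
  {p | u ∈ Ω ∧ ∀ ε : ℝ, 0 < ε → ∀ᶠ u' in 𝓝[Ω] u, inner ℝ p (u' - u) ≤ ε * ‖u' - u‖}

/-- The limiting (Mordukhovich) normal cone: the Painlevé-Kuratowski outer limit of the
regular normal cones. -/
def limitingNormalCone (Ω : Set E) (u : E) : Set E :=
  {p | ∃ (us ps : ℕ → E), Tendsto us atTop (𝓝 u) ∧ Tendsto ps atTop (𝓝 p) ∧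
    ∀ k, ps k ∈ regularNormalCone Ω (us k)}

/-- The graph of a set-valued mapping, as a subset of the Hilbert product space. -/
def graph (Ψ : E → Set F) : Set (WithLp 2 (E × F)) :=
  {w | w.snd ∈ Ψ w.fst}

/-- The limiting coderivative `D^*Ψ(u,v)(q)`. -/
def coderivative (Ψ : E → Set F) (u : E) (v : F) (q : F) : Set E :=
  {p | WithLp.toLp 2 (p, -q) ∈ limitingNormalCone (graph Ψ) (WithLp.toLp 2 (u, v))}

/-- The linearity space of a cone: the largest linear subspace contained in it. -/
def linealitySpace {V : Type*} [AddCommGroup V] [Module ℝ V] (C : Set V) : Submodule ℝ V :=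
  sSup {S : Submodule ℝ V | (S : Set V) ⊆ C}

end Variational

/-! ### Second-order cones -/

/-- `ȳ`, the vector `y` with its component of index `0` removed. -/
def tail {r : ℕ} (y : EuclideanSpace ℝ (Fin (r + 1))) : EuclideanSpace ℝ (Fin r) :=
  WithLp.toLp 2 (fun k => y k.succ)

/-- The second-order cone `{y | ‖ȳ‖ ≤ ẏ}` of `ℝ^{1+r}`; for `r = 0` it is `[0,∞)`. -/
def soc (r : ℕ) : Set (EuclideanSpace ℝ (Fin (r + 1))) :=
  {y | ‖tail y‖ ≤ y 0}

/-- `(ẏ; -ȳ)`. -/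
def reflect {r : ℕ} (y : EuclideanSpace ℝ (Fin (r + 1))) : Fin (r + 1) → ℝ :=
  Fin.cons (y 0) (fun k => -y k.succ)

/-- The block diagonal matrix `diag(1, -I_r)`. -/
def reflMatrix (r : ℕ) : Matrix (Fin (r + 1)) (Fin (r + 1)) ℝ :=
  Matrix.diagonal (Fin.cons 1 (fun _ => -1))

/-! ### Jacobian and Hessian matrices -/

/-- The Jacobian matrix of `φ` at `x`. -/
def jacobian {n k : ℕ} (φ : EuclideanSpace ℝ (Fin n) → EuclideanSpace ℝ (Fin k))
    (x : EuclideanSpace ℝ (Fin n)) : Matrix (Fin k) (Fin n) ℝ :=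
  Matrix.of fun a b => (fderiv ℝ φ x (EuclideanSpace.single b 1)) a

/-- The Hessian matrix of `φ` at `x`. -/
def hessian {n : ℕ} (φ : EuclideanSpace ℝ (Fin n) → ℝ)
    (x : EuclideanSpace ℝ (Fin n)) : Matrix (Fin n) (Fin n) ℝ :=
  Matrix.of fun a b =>
    fderiv ℝ (fderiv ℝ φ) x (EuclideanSpace.single a 1) (EuclideanSpace.single b 1)

/-! ### Nonlinear second-order cone programs -/

/-- The data of the problem `min f(x)` s.t. `h(x) = 0`, `g^j(x) ∈ Q_j` (`j = 1, …, J`),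
with twice continuously differentiable functions. -/
structure Problem (n m J : ℕ) (r : Fin J → ℕ) where
  f : EuclideanSpace ℝ (Fin n) → ℝ
  h : EuclideanSpace ℝ (Fin n) → EuclideanSpace ℝ (Fin m)
  g : (j : Fin J) → EuclideanSpace ℝ (Fin n) → EuclideanSpace ℝ (Fin (r j + 1))
  contDiff_f : ContDiff ℝ 2 f
  contDiff_h : ContDiff ℝ 2 h
  contDiff_g : ∀ j, ContDiff ℝ 2 (g j)

/-- The space of constraint values `ℝ^m × ∏_j ℝ^{1+r_j}`. Only its vector space structure and
its topology are used (in tangent cones, derivatives and subspaces). -/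
abbrev ConstraintSpace (m J : ℕ) (r : Fin J → ℕ) : Type :=
  EuclideanSpace ℝ (Fin m) × ((j : Fin J) → EuclideanSpace ℝ (Fin (r j + 1)))

/-- The cone `K = {0} × ∏_j Q_j`. -/
def coneK (m J : ℕ) (r : Fin J → ℕ) : Set (ConstraintSpace m J r) :=
  {y | y.1 = 0 ∧ ∀ j, y.2 j ∈ soc (r j)}

namespace Problem

variable {n m J : ℕ} {r : Fin J → ℕ} (P : Problem n m J r)

/-- The constraint mapping `G = (h, g^1, …, g^J)`; the constraints read `G(x) ∈ K`. -/
def G (x : EuclideanSpace ℝ (Fin n)) : ConstraintSpace m J r :=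
  (P.h x, fun j => P.g j x)

/-- The feasible set. -/
def feasible : Set (EuclideanSpace ℝ (Fin n)) := {x | P.G x ∈ coneK m J r}

/-- `x` is a locally optimal solution. -/
def IsLocallyOptimal (x : EuclideanSpace ℝ (Fin n)) : Prop :=
  x ∈ P.feasible ∧ IsLocalMinOn P.f P.feasible x

/-- The Lagrangian `L(x, λ, μ) = f(x) - ⟨λ, h(x)⟩ - ∑_j ⟨μ^j, g^j(x)⟩`. -/
def lagrangian (lam : EuclideanSpace ℝ (Fin m))
    (mu : (j : Fin J) → EuclideanSpace ℝ (Fin (r j + 1))) (x : EuclideanSpace ℝ (Fin n)) : ℝ :=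
  P.f x - inner ℝ lam (P.h x) - ∑ j, inner ℝ (mu j) (P.g j x)

/-- `(λ, μ)` is a multiplier associated with `x`, i.e. the KKT system holds:
`∇_x L(x, λ, μ) = 0`, `-λ ∈ N_{{0}}(h(x))`, `-μ^j ∈ N_{Q_j}(g^j(x))`. -/
def IsMultiplier (x : EuclideanSpace ℝ (Fin n)) (lam : EuclideanSpace ℝ (Fin m))
    (mu : (j : Fin J) → EuclideanSpace ℝ (Fin (r j + 1))) : Prop :=
  fderiv ℝ (P.lagrangian lam mu) x = 0 ∧ -lam ∈ normalCone {0} (P.h x) ∧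
    ∀ j, -mu j ∈ normalCone (soc (r j)) (P.g j x)

/-- The tangent cone `T_K(G(x))`. (Scalars in `ℝ≥0` give the usual one-sided tangent cone.) -/
def tangentK (x : EuclideanSpace ℝ (Fin n)) : Set (ConstraintSpace m J r) :=
  tangentConeAt ℝ≥0 (coneK m J r) (P.G x)

/-- Constraint nondegeneracy: `JG(x) ℝ^n + lin T_K(G(x))` is the whole space. -/
def IsNondegenerate (x : EuclideanSpace ℝ (Fin n)) : Prop :=
  LinearMap.range (fderiv ℝ P.G x : EuclideanSpace ℝ (Fin n) →ₗ[ℝ] ConstraintSpace m J r) ⊔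
    linealitySpace (P.tangentK x) = ⊤

/-- The critical cone `{d | JG(x) d ∈ T_K(G(x)), ⟨∇f(x), d⟩ ≤ 0}`. -/
def criticalCone (x : EuclideanSpace ℝ (Fin n)) : Set (EuclideanSpace ℝ (Fin n)) :=
  {d | fderiv ℝ P.G x d ∈ P.tangentK x ∧ fderiv ℝ P.f x d ≤ 0}

/-- The affine hull of the critical cone, i.e. the smallest subspace that contains it. -/
def affCritical (x : EuclideanSpace ℝ (Fin n)) : Submodule ℝ (EuclideanSpace ℝ (Fin n)) :=
  Submodule.span ℝ (P.criticalCone x)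

/-! The classes of constraint blocks that are used (`x` is the point, `mu` the multiplier). -/

variable (x : EuclideanSpace ℝ (Fin n)) (mu : (j : Fin J) → EuclideanSpace ℝ (Fin (r j + 1)))

/-- `g^j(x)` and `μ^j` both lie in `bdry Q_j \ {0}`. -/
def J3 : Set (Fin J) :=
  {j | P.g j x ∈ frontier (soc (r j)) \ {0} ∧ mu j ∈ frontier (soc (r j)) \ {0}}

/-- `g^j(x) = 0` and `μ^j ∈ bdry Q_j \ {0}`. -/
def J4 : Set (Fin J) :=
  {j | P.g j x = 0 ∧ mu j ∈ frontier (soc (r j)) \ {0}}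

/-- `g^j(x) ∈ bdry Q_j \ {0}` and `μ^j = 0`. -/
def J5 : Set (Fin J) :=
  {j | P.g j x ∈ frontier (soc (r j)) \ {0} ∧ mu j = 0}

/-- `g^j(x) = 0` and `μ^j = 0`. -/
def J6 : Set (Fin J) :=
  {j | P.g j x = 0 ∧ mu j = 0}

open Classical in
/-- `Θ = ∇²_xx L(x, λ, μ) - ∑_{j ∈ J_3} (μ̇^j / ġ^j(x)) ∇g^j(x) diag(1, -I) Jg^j(x)`. -/
def Theta (lam : EuclideanSpace ℝ (Fin m)) : Matrix (Fin n) (Fin n) ℝ :=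
  hessian (P.lagrangian lam mu) x -
    ∑ j with j ∈ P.J3 x mu, (mu j 0 / P.g j x 0) •
      ((jacobian (P.g j) x).transpose * reflMatrix (r j) * jacobian (P.g j) x)

variable {l : ℕ} (H : Matrix (Fin n) (Fin l) ℝ)

open Classical in
/-- The row vector `𝒢_j` for `j ∈ J_4` (first case) and `j ∈ J_5` (second case). -/
def calGRow (j : Fin J) : Fin l → ℝ :=
  if j ∈ P.J4 x mu then Matrix.vecMul (reflect (mu j)) (jacobian (P.g j) x * H)
  else Matrix.vecMul (reflect (P.g j x)) (jacobian (P.g j) x * H)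

/-- The matrix `𝒢_j = Jg^j(x) H` for `j ∈ J_6`. -/
def calGMat (j : Fin J) : Matrix (Fin (r j + 1)) (Fin l) ℝ :=
  jacobian (P.g j) x * H

open Classical in
/-- The number of rows of `𝒢_j`: `1 + r_j` if `j ∈ J_6`, and `1` if `j ∈ J_4 ∪ J_5`. -/
def numRows (j : Fin J) : ℕ := if j ∈ P.J6 x mu then r j + 1 else 1

theorem numRows_le (j : Fin J) : P.numRows x mu j ≤ r j + 1 := by
  unfold numRows
  split_ifs <;> omega

open Classical in
/-- `𝒢_j` as a matrix, for every `j ∈ J_4 ∪ J_5 ∪ J_6`: a row vector if `j ∈ J_4 ∪ J_5`, and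
`Jg^j(x) H` if `j ∈ J_6` (the cast of the row index is then the identity). -/
def calG (j : Fin J) : Matrix (Fin (P.numRows x mu j)) (Fin l) ℝ :=
  Matrix.of fun k =>
    if j ∈ P.J6 x mu then P.calGMat x H j (Fin.castLE (P.numRows_le x mu j) k)
    else P.calGRow x mu H j

open Classical in
/-- The reduced coderivative condition: for all `ν ≠ 0`, `Hᵀ Θ H ν` is not of the form
`-(∑_{j ∈ J_4 ∪ J_5} 𝒢_jᵀ p^j + ∑_{j ∈ J_6} 𝒢_jᵀ p^j)` with
`p^j ∈ D^*N_{[0,∞)}(0,0)(𝒢_j ν)` for `j ∈ J_4 ∪ J_5` and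
`p^j ∈ D^*N_{Q_j}(0,0)(𝒢_j ν)` for `j ∈ J_6`. -/
def ReducedCoderivativeCondition (lam : EuclideanSpace ℝ (Fin m)) : Prop :=
  ∀ ν : Fin l → ℝ, ν ≠ 0 →
    ∀ (p : Fin J → ℝ) (q : (j : Fin J) → EuclideanSpace ℝ (Fin (r j + 1))),
      (∀ j ∈ P.J4 x mu ∪ P.J5 x mu,
        p j ∈ coderivative (normalCone (Set.Ici (0 : ℝ))) 0 0 (P.calGRow x mu H j ⬝ᵥ ν)) →
      (∀ j ∈ P.J6 x mu,
        q j ∈ coderivative (normalCone (soc (r j))) 0 0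
          (WithLp.toLp 2 ((P.calGMat x H j).mulVec ν))) →
      (H.transpose * P.Theta x mu lam * H).mulVec ν ≠
        -((∑ j with j ∈ P.J4 x mu ∪ P.J5 x mu, p j • P.calGRow x mu H j) +
          ∑ j with j ∈ P.J6 x mu, (P.calGMat x H j).transpose.mulVec (q j))

/-- The number `|J_4 ∪ J_5 ∪ J_6|`. -/
def card456 : ℕ := (P.J4 x mu ∪ P.J5 x mu ∪ P.J6 x mu).ncard

/-- `idx` enumerates `J_4 ∪ J_5 ∪ J_6`, first the elements of `J_4`, then those of `J_5`, and
then those of `J_6`. The positions are counted from `0`: `idx i` is `j_{i+1}`. -/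
def IsOrderedEnumeration (idx : Fin (P.card456 x mu) → Fin J) : Prop :=
  Function.Injective idx ∧ Set.range idx = P.J4 x mu ∪ P.J5 x mu ∪ P.J6 x mu ∧
    (∀ i : Fin (P.card456 x mu), (i : ℕ) < (P.J4 x mu).ncard → idx i ∈ P.J4 x mu) ∧
    (∀ i : Fin (P.card456 x mu), (P.J4 x mu).ncard ≤ (i : ℕ) →
      (i : ℕ) < (P.J4 x mu ∪ P.J5 x mu).ncard →
      idx i ∈ P.J5 x mu)

/-- The number of columns of `P_i`, i.e. `ℓ` minus the total number of rows of
`𝒢_{j_1}, …, 𝒢_{j_i}`. (The value for `i > |J_4 ∪ J_5 ∪ J_6|` plays no role.) -/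
def redDim (l : ℕ) (idx : Fin (P.card456 x mu) → Fin J) : ℕ → ℕ
  | 0 => l
  | i + 1 => redDim l idx i -
      (if hi : i < P.card456 x mu then P.numRows x mu (idx ⟨i, hi⟩) else 0)

/-- `P_i = R_1 ⋯ R_i`, with `P_0` the identity. The matrices are indexed so that `R i` is
`R_{i+1}`. -/
def prodMat {l : ℕ} {idx : Fin (P.card456 x mu) → Fin J}
    (R : (i : ℕ) →
      Matrix (Fin (P.redDim x mu l idx i)) (Fin (P.redDim x mu l idx (i + 1))) ℝ) :
    (i : ℕ) → Matrix (Fin l) (Fin (P.redDim x mu l idx i)) ℝ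
  | 0 => (1 : Matrix (Fin l) (Fin l) ℝ)
  | i + 1 => prodMat R i * R i

/-- `T_i = P_iᵀ Hᵀ Θ H P_i`; in particular `T_0 = Hᵀ Θ H`. -/
def redMat {l : ℕ} (H : Matrix (Fin n) (Fin l) ℝ) (lam : EuclideanSpace ℝ (Fin m))
    {idx : Fin (P.card456 x mu) → Fin J}
    (R : (i : ℕ) →
      Matrix (Fin (P.redDim x mu l idx i)) (Fin (P.redDim x mu l idx (i + 1))) ℝ) (i : ℕ) :
    Matrix (Fin (P.redDim x mu l idx i)) (Fin (P.redDim x mu l idx i)) ℝ :=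
  (P.prodMat x mu R i).transpose * H.transpose * P.Theta x mu lam * H * P.prodMat x mu R i

end Problem

end NSOCP

end

/-! Everything reduces to one fact: `Hᵀ Θ H` is positive definite. Under nondegeneracy the matrices
`𝒢_j` are jointly surjective on `ℝ^ℓ`, because any values of the rows and blocks are attained on the
span of the critical cone (`exists_mem_affCritical`). Hence each `𝒢_{j_i} P_{i-1}` is onto. By a
dimension count each `R_i`, and so each `P_i`, is injective. Then `T_i = P_iᵀ (Hᵀ Θ H) P_i` is
positive definite, and so is `B T⁻¹ Bᵀ` for `B = 𝒢_{j_i} P_{i-1}`, whose rows are independent.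

Positive definiteness (`posDef_reducedHessian`) starts from a subspace and is spread out block by
block. On the common kernel of all `𝒢_j` the direction `Hν` maps into the lineality space of the
tangent cone. By the implicit function theorem it is tangent to a feasible curve that stays on the
faces of the cones, and local optimality along this curve gives `νᵀ Hᵀ Θ H ν ≥ 0`
(`second_order_necessary`).

The coderivative condition says that `M ν + ∑ φ_j = 0`, with `φ_j = 𝒢_jᵀ p^j` and `p^j` in the
coderivative at `𝒢_j ν`, forces `ν = 0`. For `𝒢_j ν = 0` every `p^j` is allowed, and `p^j = 0` is
always allowed. So a null vector of `M` on the common kernel would solve the system, and `M` is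
positive definite there. The kernels are then released one block at a time (`posOn_top_of_climbs`).

To release one block, suppose that `M` is positive definite on `U ∩ ker π` but not on `U`. Then `M +
s π*π` is semidefinite and degenerate on `U` for some `s ≥ 0`; a null vector `ν` satisfies `M ν = -s
π*π ν` on `U`. It remains to recognize the right-hand side as a coderivative element. For a
half-line `s 𝒢_j ν` works up to the sign of `ν`, which is free. For a second-order cone the kernel
is released in three stages along a fixed pair of opposite boundary rays (`climbs_soc_of_unit`). The
required normals are regular normals at complementary pairs, which can be scaled into the origin
because the complementarity set is a cone. Only membership in the coderivative is ever needed, never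
a full formula for it. -/

noncomputable section

namespace NSOCP

/-! ### Positive definite forms on nested subspaces -/

section Forms

variable {V : Type*} [AddCommGroup V] [Module ℝ V]

/-- The bilinear form `M` is positive definite on the subspace `U`. -/
def PosOn (M : V →ₗ[ℝ] V →ₗ[ℝ] ℝ) (U : Submodule ℝ V) : Prop :=
  ∀ v ∈ U, v ≠ 0 → 0 < M v v

/-- Since `M u u = 0`, the form at `t • u + v` is affine in `t`, and an affine function bounded
below is constant. -/
theorem eq_zero_of_nonneg_of_self_eq_zero {M : V →ₗ[ℝ] V →ₗ[ℝ] ℝ} (hM : ∀ u v, M u v = M v u)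
    {U : Submodule ℝ V} (h : ∀ v ∈ U, 0 ≤ M v v) {u v : V} (hu : u ∈ U) (hv : v ∈ U)
    (h0 : M u u = 0) : M u v = 0 := by
  have key : ∀ t : ℝ, 0 ≤ 2 * t * M u v + M v v := by
    intro t
    have := h (t • u + v) (U.add_mem (U.smul_mem t hu) hv)
    simp only [map_add, map_smul, LinearMap.add_apply, LinearMap.smul_apply, smul_eq_mul, h0,
      hM v u] at this
    linarith
  by_contra hne
  have := key (-(M v v + 1) / (2 * M u v))
  have h2 : 2 * (-(M v v + 1) / (2 * M u v)) * M u v = -(M v v + 1) := by field_simp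
  rw [h2] at this
  linarith

/-- A linear functional that vanishes on `U ∩ ker L` factors through `L` on `U`. -/
theorem exists_inner_eq_of_ker {E : Type*} [NormedAddCommGroup E] [InnerProductSpace ℝ E]
    [FiniteDimensional ℝ E] (f : V →ₗ[ℝ] ℝ) (L : V →ₗ[ℝ] E) (U : Submodule ℝ V)
    (h : ∀ v ∈ U, L v = 0 → f v = 0) : ∃ p : E, ∀ v ∈ U, f v = inner ℝ p (L v) := by
  obtain ⟨g, hg⟩ : ∃ g : E →ₗ[ℝ] ℝ, g ∘ₗ (L ∘ₗ U.subtype) = f ∘ₗ U.subtype := by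
    have hk : LinearMap.ker (L ∘ₗ U.subtype) ≤ LinearMap.ker (f ∘ₗ U.subtype) := by
      intro v hv
      exact h v v.2 hv
    have := LinearMap.range_dualMap_eq_dualAnnihilator_ker (L ∘ₗ U.subtype)
    have hf : f ∘ₗ U.subtype ∈ (LinearMap.ker (L ∘ₗ U.subtype)).dualAnnihilator := by
      rw [Submodule.mem_dualAnnihilator]
      exact fun w hw => hk hw
    rw [← this] at hf
    exact hf
  refine ⟨(InnerProductSpace.toDual ℝ E).symm (LinearMap.toContinuousLinearMap g), fun v hv => ?_⟩
  rw [InnerProductSpace.toDual_symm_apply]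
  exact (LinearMap.congr_fun hg ⟨v, hv⟩).symm

end Forms

/-! ### Degenerate penalized forms -/

section Eigen

variable {V : Type*} [NormedAddCommGroup V] [NormedSpace ℝ V] [FiniteDimensional ℝ V]
  {E : Type*} [NormedAddCommGroup E] [InnerProductSpace ℝ E]

/-- If `M` is positive definite on `U ∩ ker π` but not on `U`, then `M + s π*π` is degenerate on
`U` for some `s ≥ 0`. -/
theorem exists_degenerate_of_not_posOn {M : V →ₗ[ℝ] V →ₗ[ℝ] ℝ} (hM : ∀ u v, M u v = M v u)
    (U : Submodule ℝ V) (π : V →ₗ[ℝ] E) (hker : PosOn M (U ⊓ LinearMap.ker π))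
    (hU : ¬ PosOn M U) :
    ∃ ν ∈ U, ν ≠ 0 ∧ ∃ s : ℝ, 0 ≤ s ∧ ∀ v ∈ U, M ν v = -s * inner ℝ (π ν) (π v) := by
  have hMc : Continuous fun v => M v v := by
    let B : V →ₗ[ℝ] V →L[ℝ] ℝ :=
      (LinearMap.toContinuousLinearMap : (V →ₗ[ℝ] ℝ) ≃ₗ[ℝ] (V →L[ℝ] ℝ)).toLinearMap ∘ₗ M
    have hB : Continuous B := B.continuous_of_finiteDimensional
    exact hB.clm_apply continuous_id
  have hπc : Continuous π := π.continuous_of_finiteDimensional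
  -- `S` is compact, and `π` vanishes nowhere on it by `hker`, so the ratio `-M v v / ‖π v‖ ^ 2`
  -- attains its maximum on `S`.
  set S : Set V := {v | v ∈ U ∧ ‖v‖ = 1 ∧ M v v ≤ 0} with hS
  have hScl : IsClosed S := by
    have : S = (U : Set V) ∩ ({v | ‖v‖ = 1} ∩ {v | M v v ≤ 0}) := rfl
    rw [this]
    exact (U.closed_of_finiteDimensional).inter
      ((isClosed_eq continuous_norm continuous_const).inter (isClosed_le hMc continuous_const))
  have : ProperSpace V := FiniteDimensional.proper ℝ V
  have hSc : IsCompact S := by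
    refine (isCompact_closedBall (0 : V) 1).of_isClosed_subset hScl ?_
    intro v hv
    simpa using hv.2.1.le
  have hπS : ∀ v ∈ S, 0 < ‖π v‖ ^ 2 := by
    intro v hv
    have hne : v ≠ 0 := by
      intro h
      have := hv.2.1
      simp [h] at this
    have : π v ≠ 0 := fun h => absurd (hker v ⟨hv.1, h⟩ hne) (not_lt.mpr hv.2.2)
    positivity
  have hscale : ∀ v ∈ U, v ≠ 0 → M v v ≤ 0 → (‖v‖⁻¹ • v) ∈ S := by
    intro v hv hne hle
    have hn : ‖v‖ ≠ 0 := norm_ne_zero_iff.mpr hne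
    refine ⟨U.smul_mem _ hv, ?_, ?_⟩
    · rw [norm_smul, norm_inv, norm_norm, inv_mul_cancel₀ hn]
    · simp only [map_smul, LinearMap.smul_apply, smul_eq_mul]
      have : 0 ≤ ‖v‖⁻¹ * ‖v‖⁻¹ := by positivity
      nlinarith
  have hne : S.Nonempty := by
    simp only [PosOn, not_forall, not_lt] at hU
    obtain ⟨v, hv, hne, hle⟩ := hU
    exact ⟨_, hscale v hv hne hle⟩
  have hcont : ContinuousOn (fun v => -M v v / ‖π v‖ ^ 2) S := by
    refine ContinuousOn.div hMc.neg.continuousOn (hπc.norm.pow 2).continuousOn ?_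
    intro v hv
    exact (hπS v hv).ne'
  obtain ⟨ν, hν, hmax⟩ := hSc.exists_isMaxOn hne hcont
  set s : ℝ := -M ν ν / ‖π ν‖ ^ 2 with hs
  have hs0 : 0 ≤ s := div_nonneg (by linarith [hν.2.2]) (hπS ν hν).le
  -- The maximal ratio `s` is the smallest weight that makes the penalized form nonnegative on `U`;
  -- the maximizer `ν` is then a null vector, hence in the radical on `U`.
  let Q : V →ₗ[ℝ] V →ₗ[ℝ] ℝ := M + s • ((innerₗ E).compl₁₂ π π)
  have hQ : ∀ u v, Q u v = M u v + s * inner ℝ (π u) (π v) := by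
    intro u v
    simp [Q]
  have hQs : ∀ u v, Q u v = Q v u := by
    intro u v
    rw [hQ, hQ, hM, real_inner_comm]
  have hQn : ∀ v ∈ U, 0 ≤ Q v v := by
    intro v hv
    rw [hQ, real_inner_self_eq_norm_sq]
    by_cases h0 : v = 0
    · simp [h0]
    rcases le_or_gt (M v v) 0 with hle | hgt
    · have hm := hmax (hscale v hv h0 hle)
      have hp := hπS _ (hscale v hv h0 hle)
      have hn : ‖v‖ ≠ 0 := norm_ne_zero_iff.mpr h0
      simp only [Set.mem_ofPred_eq] at hm
      rw [div_le_iff₀ hp, ← hs] at hm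
      simp only [map_smul, LinearMap.smul_apply, smul_eq_mul, norm_smul, norm_inv, norm_norm] at hm
      have h2 : -(‖v‖⁻¹ * (‖v‖⁻¹ * M v v)) * ‖v‖ ^ 2 ≤ s * (‖v‖⁻¹ * ‖π v‖) ^ 2 * ‖v‖ ^ 2 :=
        mul_le_mul_of_nonneg_right hm (by positivity)
      have h3 : -(‖v‖⁻¹ * (‖v‖⁻¹ * M v v)) * ‖v‖ ^ 2 = -M v v := by field_simp
      have h4 : s * (‖v‖⁻¹ * ‖π v‖) ^ 2 * ‖v‖ ^ 2 = s * ‖π v‖ ^ 2 := by field_simp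
      linarith
    · positivity
  have hQν : Q ν ν = 0 := by
    rw [hQ, real_inner_self_eq_norm_sq, hs, div_mul_cancel₀ _ (hπS ν hν).ne']
    ring
  refine ⟨ν, hν.1, ?_, s, hs0, fun v hv => ?_⟩
  · intro h
    have := hν.2.1
    simp [h] at this
  · have := eq_zero_of_nonneg_of_self_eq_zero hQs hQn hν.1 hv hQν
    rw [hQ] at this
    linarith

end Eigen

/-! ### Release of the kernels one block at a time -/

section Climb

variable {V : Type*} [AddCommGroup V] [Module ℝ V]

/-- Positive definiteness passes from `U ∩ N` to `U` for every `U`, unless the critical point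
system described by `Rel` has a nontrivial solution. -/
def Climbs (M : V →ₗ[ℝ] V →ₗ[ℝ] ℝ) (N : Submodule ℝ V) (Rel : V → (V →ₗ[ℝ] ℝ) → Prop) : Prop :=
  ∀ U : Submodule ℝ V, PosOn M (U ⊓ N) →
    (∀ ν ∈ U, ∀ φ, Rel ν φ → (∀ v ∈ U, M ν v + φ v = 0) → ν = 0) → PosOn M U

/-- In finite dimension the annihilator of an intersection is the sum of the annihilators. -/
theorem exists_sum_of_vanish [FiniteDimensional ℝ V] {ι : Type*} [Finite ι]
    (N : ι → Submodule ℝ V) (f : V →ₗ[ℝ] ℝ) (h : ∀ v ∈ ⨅ i, N i, f v = 0) :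
    ∃ φ : ι → (V →ₗ[ℝ] ℝ), (∀ i, ∀ v ∈ N i, φ i v = 0) ∧ f = ∑ᶠ i, φ i := by
  have hf : f ∈ (⨅ i, N i).dualAnnihilator := by
    rw [Submodule.mem_dualAnnihilator]; exact h
  rw [Subspace.dualAnnihilator_iInf_eq, Submodule.mem_iSup_iff_exists_finsupp] at hf
  obtain ⟨g, hg, hsum⟩ := hf
  refine ⟨g, fun i v hv => (Submodule.mem_dualAnnihilator _).mp (hg i) v hv, ?_⟩
  rw [← hsum, Finsupp.sum, finsum_eq_sum_of_support_subset]
  intro i hi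
  simpa using hi

/-- If `M` is nonnegative on the intersection of the `N i` and the system `M ν + ∑ φ i = 0`,
`Rel i ν (φ i)` has no nontrivial solution, then `M` is positive definite. -/
theorem posOn_top_of_climbs [FiniteDimensional ℝ V] {ι : Type*} [Fintype ι]
    {M : V →ₗ[ℝ] V →ₗ[ℝ] ℝ} (hM : ∀ u v, M u v = M v u)
    {N : ι → Submodule ℝ V} {Rel : ι → V → (V →ₗ[ℝ] ℝ) → Prop}
    (hzero : ∀ i ν, Rel i ν 0)
    (hN : ∀ i, ∀ ν ∈ N i, ∀ φ : V →ₗ[ℝ] ℝ, (∀ v ∈ N i, φ v = 0) → Rel i ν φ)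
    (hclimb : ∀ i, Climbs M (N i) (Rel i))
    (hbase : ∀ v ∈ ⨅ i, N i, 0 ≤ M v v)
    (hsys : ∀ ν, ∀ φ : ι → (V →ₗ[ℝ] ℝ), (∀ i, Rel i ν (φ i)) → M ν + ∑ i, φ i = 0 → ν = 0) :
    PosOn M ⊤ := by
  classical
  -- `s` is the set of blocks whose kernel constraint has already been released.
  suffices H : ∀ s : Finset ι, PosOn M (⨅ i : {i // i ∉ s}, N i) by
    have hemp : IsEmpty {i // i ∉ (Finset.univ : Finset ι)} := ⟨fun i => i.2 (Finset.mem_univ _)⟩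
    have := H Finset.univ
    rwa [iInf_of_empty] at this
  intro s
  induction s using Finset.induction_on with
  | empty =>
    intro v hv hne
    have hv' : v ∈ ⨅ i, N i := by
      simpa [Submodule.mem_iInf] using hv
    -- A null vector `v` makes `M v` vanish on the common kernel; splitting `-M v` over the
    -- annihilators of the `N i` turns `v` into a solution of the full system.
    refine lt_of_le_of_ne (hbase v hv') fun h0 => hne ?_
    have hvan : ∀ w ∈ ⨅ i, N i, (-M v) w = 0 := fun w hw => by
      rw [LinearMap.neg_apply, eq_zero_of_nonneg_of_self_eq_zero hM hbase hv' hw h0.symm, neg_zero]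
    obtain ⟨φ, hφ, hsum⟩ := exists_sum_of_vanish N _ hvan
    refine hsys v φ (fun i => hN i v ((Submodule.mem_iInf _).mp hv' i) _ (hφ i)) ?_
    rw [finsum_eq_sum_of_fintype] at hsum
    rw [← hsum, add_neg_cancel]
  | insert j s hj ih =>
    refine hclimb j _ (fun v hv hne => ih v ?_ hne) ?_
    · rw [Submodule.mem_inf, Submodule.mem_iInf] at hv
      rw [Submodule.mem_iInf]
      rintro ⟨i, hi⟩
      by_cases hij : i = j
      · subst hij; exact hv.2
      · exact hv.1 ⟨i, by simp [hij, hi]⟩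
    · intro ν hν φ hφ hvan
      have hvan' : ∀ w ∈ ⨅ i : {i // i ∉ insert j s}, N i, (-(M ν + φ)) w = 0 := fun w hw => by
        rw [LinearMap.neg_apply, LinearMap.add_apply, hvan w hw, neg_zero]
      obtain ⟨ψ, hψ, hsum⟩ := exists_sum_of_vanish (fun i : {i // i ∉ insert j s} => N i) _ hvan'
      rw [finsum_eq_sum_of_fintype] at hsum
      -- The equation known on `U` only is completed to one on `V`: blocks still constrained absorb
      -- the remainder through their annihilators, block `j` carries `φ`, and released blocks
      -- contribute `0`.
      let χ : ι → (V →ₗ[ℝ] ℝ) := fun i =>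
        if h : i ∉ insert j s then ψ ⟨i, h⟩ else if i = j then φ else 0
      refine hsys ν χ (fun i => ?_) ?_
      · by_cases h : i ∉ insert j s
        · simp only [χ, dif_pos h]
          exact hN i ν ((Submodule.mem_iInf _).mp hν ⟨i, h⟩) _ (hψ ⟨i, h⟩)
        · simp only [χ, dif_neg h]
          split_ifs with hij
          · subst hij; exact hφ
          · exact hzero i ν
      · have hχ : ∑ i, χ i = φ + ∑ i : {i // i ∉ insert j s}, ψ i := by
          rw [← Finset.sum_add_sum_compl (insert j s) χ, Finset.sum_insert hj]
          have h1 : χ j = φ := by simp [χ]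
          have h2 : ∑ i ∈ s, χ i = 0 := by
            refine Finset.sum_eq_zero fun i hi => ?_
            have hij : i ≠ j := fun h => hj (h ▸ hi)
            simp [χ, hi, hij]
          have h3 : ∑ i ∈ (insert j s)ᶜ, χ i = ∑ i : {i // i ∉ insert j s}, ψ i := by
            rw [← Finset.sum_subtype (p := fun i => i ∉ insert j s) (insert j s)ᶜ
              (fun i => Finset.mem_compl) χ |>.symm]
            refine Finset.sum_congr rfl fun i _ => ?_
            have := i.2
            simp only [χ, dif_pos this]
          rw [h1, h2, h3, add_zero]
        rw [hχ, ← hsum]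
        abel

end Climb

/-! ### Coderivatives of normal cone mappings of self-dual cones -/

section SelfDual

variable {E : Type*} [NormedAddCommGroup E] [InnerProductSpace ℝ E]

/-- `K` is its own dual cone. -/
def IsSelfDual (K : Set E) : Prop := ∀ y, y ∈ K ↔ ∀ x ∈ K, 0 ≤ inner ℝ x y

namespace IsSelfDual

variable {K : Set E} (hK : IsSelfDual K)
include hK

theorem inner_nonneg {x y : E} (hx : x ∈ K) (hy : y ∈ K) : 0 ≤ inner ℝ x y := (hK y).mp hy x hx

theorem zero_mem : (0 : E) ∈ K := (hK 0).mpr fun x _ => by simp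

theorem smul_mem {x : E} (hx : x ∈ K) {c : ℝ} (hc : 0 ≤ c) : c • x ∈ K :=
  (hK _).mpr fun y hy => by
    rw [real_inner_smul_right]; exact mul_nonneg hc (hK.inner_nonneg hy hx)

theorem add_mem {x y : E} (hx : x ∈ K) (hy : y ∈ K) : x + y ∈ K :=
  (hK _).mpr fun z hz => by
    rw [inner_add_right]; exact add_nonneg (hK.inner_nonneg hz hx) (hK.inner_nonneg hz hy)

/-- Testing a normal at the points `0` and `2x` shows that it is orthogonal to `x`; self-duality
then places its negative in `K`. The graph of the normal cone mapping is thus the complementarity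
set with the second component negated. -/
theorem mem_normalCone_iff {x v : E} :
    v ∈ normalCone K x ↔ x ∈ K ∧ -v ∈ K ∧ inner ℝ x (-v) = 0 := by
  constructor
  · rintro ⟨hx, hv⟩
    have h0 : inner ℝ v x = 0 := by
      have h1 := hv 0 hK.zero_mem
      have h2 := hv ((2 : ℝ) • x) (hK.smul_mem hx (by norm_num))
      rw [two_smul, add_sub_cancel_right] at h2
      rw [zero_sub, inner_neg_right] at h1
      linarith
    refine ⟨hx, (hK _).mpr fun y hy => ?_, ?_⟩
    · have := hv y hy
      rw [inner_sub_right, h0, real_inner_comm] at this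
      rw [inner_neg_right]
      linarith
    · rw [inner_neg_right, real_inner_comm, h0, neg_zero]
  · rintro ⟨hx, hv, h0⟩
    refine ⟨hx, fun y hy => ?_⟩
    have := hK.inner_nonneg hy hv
    rw [inner_neg_right, real_inner_comm] at this h0
    rw [inner_sub_right]
    linarith

end IsSelfDual

/-- `(p, q)` is a regular normal to the complementarity set `{(x, y) ∈ K × K | ⟨x, y⟩ = 0}`
at `(x, y)`. -/
def CompNormal (K : Set E) (p q x y : E) : Prop :=
  ∀ ε : ℝ, 0 < ε → ∃ δ : ℝ, 0 < δ ∧ ∀ x' ∈ K, ∀ y' ∈ K, inner ℝ x' y' = (0 : ℝ) →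
    ‖x' - x‖ < δ → ‖y' - y‖ < δ →
      inner ℝ p (x' - x) + inner ℝ q (y' - y) ≤ ε * (‖x' - x‖ + ‖y' - y‖)

theorem CompNormal.symm {K : Set E} {p q x y : E} (h : CompNormal K p q x y) :
    CompNormal K q p y x := by
  intro ε hε
  obtain ⟨δ, hδ, H⟩ := h ε hε
  refine ⟨δ, hδ, fun x' hx' y' hy' h0 hx hy => ?_⟩
  rw [real_inner_comm] at h0
  have := H y' hy' x' hx' h0 hy hx
  linarith

/-- The complementarity set is a cone, so its regular normals are constant along rays; this
transports normals towards the origin. -/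
theorem CompNormal.smul {K : Set E} (hK : IsSelfDual K) {p q x y : E} (h : CompNormal K p q x y)
    {c : ℝ} (hc : 0 < c) : CompNormal K p q (c • x) (c • y) := by
  intro ε hε
  obtain ⟨δ, hδ, H⟩ := h ε hε
  have key : ∀ u v : E, u - c • v = c • (c⁻¹ • u - v) := fun u v => by
    rw [smul_sub, smul_inv_smul₀ hc.ne']
  refine ⟨c * δ, by positivity, fun x' hx' y' hy' h0 hx hy => ?_⟩
  rw [key, norm_smul, Real.norm_of_nonneg hc.le] at hx hy
  have := H (c⁻¹ • x') (hK.smul_mem hx' (by positivity)) (c⁻¹ • y')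
    (hK.smul_mem hy' (by positivity)) (by simp [real_inner_smul_left, real_inner_smul_right, h0])
    (lt_of_mul_lt_mul_left hx hc.le) (lt_of_mul_lt_mul_left hy hc.le)
  rw [key, key, inner_smul_right, inner_smul_right, norm_smul, norm_smul,
    Real.norm_of_nonneg hc.le]
  nlinarith

/-- The pair stays a regular normal along the points `(x, y) / (k + 1)`, which tend to the origin,
so it is a limiting normal there. The sign of the second component turns `y` into `-y` and `q` into
`-q`. -/
theorem CompNormal.mem_coderivative {K : Set E} (hK : IsSelfDual K) {p q x y : E}
    (h : CompNormal K p q x y) (hx : x ∈ K) (hy : y ∈ K) (hxy : inner ℝ x y = (0 : ℝ)) :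
    p ∈ coderivative (normalCone K) 0 0 q := by
  have hlim : Tendsto (fun k : ℕ => 1 / ((k : ℝ) + 1)) atTop (𝓝 0) :=
    tendsto_one_div_add_atTop_nhds_zero_nat
  refine ⟨fun k => (1 / ((k : ℝ) + 1)) • WithLp.toLp 2 (x, -y), fun _ => WithLp.toLp 2 (p, -q),
    ?_, tendsto_const_nhds, fun k => ?_⟩
  · have := hlim.smul_const (WithLp.toLp 2 (x, -y))
    rw [zero_smul] at this
    exact this
  have hc : 0 < 1 / ((k : ℝ) + 1) := by positivity
  set c := 1 / ((k : ℝ) + 1)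
  have hcn := h.smul hK hc
  refine ⟨?_, fun ε hε => ?_⟩
  · change c • (-y) ∈ normalCone K (c • x)
    rw [hK.mem_normalCone_iff, smul_neg, neg_neg]
    refine ⟨hK.smul_mem hx hc.le, hK.smul_mem hy hc.le, ?_⟩
    rw [real_inner_smul_left, real_inner_smul_right, hxy]; simp
  -- Half of `ε`, since the sum of the two component norms is at most twice the norm of the Hilbert
  -- product.
  · obtain ⟨δ, hδ, H⟩ := hcn (ε / 2) (by positivity)
    rw [eventually_nhdsWithin_iff]
    filter_upwards [Metric.ball_mem_nhds (c • WithLp.toLp 2 (x, -y)) hδ] with w hw hwg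
    have hwg' : w.snd ∈ normalCone K w.fst := hwg
    rw [hK.mem_normalCone_iff] at hwg'
    obtain ⟨h1, h2, h3⟩ := hwg'
    rw [Metric.mem_ball, dist_eq_norm] at hw
    set e := w - c • WithLp.toLp 2 (x, -y) with he
    have hn := WithLp.prod_norm_sq_eq_of_L2 e
    have e1 : e.fst = w.fst - c • x := rfl
    have e2 : e.snd = -(-w.snd - c • y) := by
      change w.snd - c • (-y) = _
      rw [smul_neg]; abel
    have n1 : ‖e.fst‖ ≤ ‖e‖ := by
      refine abs_le_of_sq_le_sq' ?_ (norm_nonneg _) |>.2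
      nlinarith [sq_nonneg ‖e.snd‖]
    have n2 : ‖e.snd‖ ≤ ‖e‖ := by
      refine abs_le_of_sq_le_sq' ?_ (norm_nonneg _) |>.2
      nlinarith [sq_nonneg ‖e.fst‖]
    have n2' : ‖-w.snd - c • y‖ = ‖e.snd‖ := by rw [e2, norm_neg]
    have := H w.fst h1 (-w.snd) h2 h3 (by rw [← e1]; linarith) (by rw [n2']; linarith)
    rw [n2', ← e1] at this
    rw [WithLp.prod_inner_apply]
    change inner ℝ p e.fst + inner ℝ (-q) e.snd ≤ _
    rw [e2, inner_neg_neg]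
    nlinarith

theorem compNormal_zero {K : Set E} (hK : IsSelfDual K) {p q : E} (hp : -p ∈ K) (hq : -q ∈ K) :
    CompNormal K p q 0 0 := by
  refine fun ε hε => ⟨1, one_pos, fun x' hx' y' hy' _ _ _ => ?_⟩
  have h1 := hK.inner_nonneg hp hx'
  have h2 := hK.inner_nonneg hq hy'
  rw [inner_neg_left] at h1 h2
  rw [sub_zero, sub_zero]
  have : 0 ≤ ε * (‖x'‖ + ‖y'‖) := by positivity
  linarith

/-- The bound on `e` makes it an interior point of the dual cone: any `x'` close to `e` forces its
complementary `y'` to be `0`. Locally the complementarity set is therefore contained in `K × {0}`,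
and the second component `q` is arbitrary. -/
theorem compNormal_interior {K : Set E} {e : E} {c : ℝ} (hc : 0 < c)
    (he : ∀ y ∈ K, c * ‖y‖ ≤ inner ℝ e y) (q : E) : CompNormal K 0 q e 0 := by
  refine fun ε hε => ⟨c, hc, fun x' _ y' hy' h0 hx _ => ?_⟩
  have h1 := he y' hy'
  have h2 : inner ℝ e y' = inner ℝ (e - x') y' := by rw [inner_sub_left, h0, sub_zero]
  have h3 := real_inner_le_norm (e - x') y'
  rw [norm_sub_rev] at hx
  have hy0 : y' = 0 := by
    by_contra hne
    have : 0 < ‖y'‖ := norm_pos_iff.mpr hne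
    nlinarith
  rw [hy0]
  simp only [inner_zero_left, sub_zero, inner_zero_right, add_zero, norm_zero]
  positivity

theorem zero_mem_coderivative {K : Set E} (hK : IsSelfDual K) {e : E} (heK : e ∈ K) {c : ℝ}
    (hc : 0 < c) (he : ∀ y ∈ K, c * ‖y‖ ≤ inner ℝ e y) (q : E) :
    0 ∈ coderivative (normalCone K) 0 0 q :=
  (compNormal_interior hc he q).mem_coderivative hK heK hK.zero_mem (inner_zero_right _)

/-- The coderivative at direction `0` is the whole space, which is what lets a block with `𝒢_j ν =
0` absorb any functional. -/
theorem mem_coderivative_zero {K : Set E} (hK : IsSelfDual K) {e : E} (heK : e ∈ K) {c : ℝ}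
    (hc : 0 < c) (he : ∀ y ∈ K, c * ‖y‖ ≤ inner ℝ e y) (p : E) :
    p ∈ coderivative (normalCone K) 0 0 (0 : E) :=
  (compNormal_interior hc he p).symm.mem_coderivative hK hK.zero_mem heK (inner_zero_left _)

theorem mem_coderivative_of_neg {K : Set E} (hK : IsSelfDual K) {p q : E} (hp : -p ∈ K)
    (hq : -q ∈ K) : p ∈ coderivative (normalCone K) 0 0 q :=
  (compNormal_zero hK hp hq).mem_coderivative hK hK.zero_mem hK.zero_mem (inner_zero_right _)

theorem isSelfDual_Ici : IsSelfDual (Set.Ici (0 : ℝ)) := by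
  intro y
  refine ⟨fun hy x hx => ?_, fun h => ?_⟩
  · simp only [Set.mem_Ici] at hx hy
    simpa using mul_nonneg hy hx
  · simpa using h 1 (by simp)

theorem norm_le_inner_one_of_mem_Ici : ∀ y ∈ Set.Ici (0 : ℝ), 1 * ‖y‖ ≤ inner ℝ (1 : ℝ) y := by
  intro y hy
  simp [abs_of_nonneg (Set.mem_Ici.mp hy)]

end SelfDual

/-! ### Geometry of the second-order cone -/

section Soc

variable {r : ℕ}

/-- The vector `(a; u)` of `ℝ^{1+r}`. -/
def ofHeadTail (a : ℝ) (u : EuclideanSpace ℝ (Fin r)) : EuclideanSpace ℝ (Fin (r + 1)) :=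
  WithLp.toLp 2 (Fin.cons a (fun k => u k))

@[simp] theorem ofHeadTail_zero (a : ℝ) (u : EuclideanSpace ℝ (Fin r)) :
    ofHeadTail a u 0 = a := rfl

@[simp] theorem tail_ofHeadTail (a : ℝ) (u : EuclideanSpace ℝ (Fin r)) :
    tail (ofHeadTail a u) = u := rfl

theorem ext_head_tail {x y : EuclideanSpace ℝ (Fin (r + 1))} (h0 : x 0 = y 0)
    (ht : tail x = tail y) : x = y := by
  ext k
  refine Fin.cases h0 (fun i => ?_) k
  exact congrArg (fun w : EuclideanSpace ℝ (Fin r) => w i) ht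

theorem tail_add (x y : EuclideanSpace ℝ (Fin (r + 1))) : tail (x + y) = tail x + tail y := rfl

theorem tail_sub (x y : EuclideanSpace ℝ (Fin (r + 1))) : tail (x - y) = tail x - tail y := rfl

theorem tail_smul (c : ℝ) (x : EuclideanSpace ℝ (Fin (r + 1))) : tail (c • x) = c • tail x := rfl

theorem tail_zero : tail (0 : EuclideanSpace ℝ (Fin (r + 1))) = 0 := rfl

theorem inner_eq_head_tail (x y : EuclideanSpace ℝ (Fin (r + 1))) :
    inner ℝ x y = x 0 * y 0 + inner ℝ (tail x) (tail y) := by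
  simp only [PiLp.inner_apply, Fin.sum_univ_succ]
  simp [tail, mul_comm]

theorem norm_sq_eq_head_tail (x : EuclideanSpace ℝ (Fin (r + 1))) :
    ‖x‖ ^ 2 = x 0 ^ 2 + ‖tail x‖ ^ 2 := by
  rw [← real_inner_self_eq_norm_sq, inner_eq_head_tail, real_inner_self_eq_norm_sq]
  ring

theorem abs_head_le_norm (x : EuclideanSpace ℝ (Fin (r + 1))) : |x 0| ≤ ‖x‖ := by
  refine abs_le_of_sq_le_sq ?_ (norm_nonneg _)
  rw [norm_sq_eq_head_tail]
  nlinarith [sq_nonneg ‖tail x‖]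

theorem norm_tail_le_norm (x : EuclideanSpace ℝ (Fin (r + 1))) : ‖tail x‖ ≤ ‖x‖ := by
  refine abs_le_of_sq_le_sq' ?_ (norm_nonneg _) |>.2
  rw [norm_sq_eq_head_tail]
  nlinarith [sq_nonneg (x 0)]

theorem mem_soc {x : EuclideanSpace ℝ (Fin (r + 1))} : x ∈ soc r ↔ ‖tail x‖ ≤ x 0 := Iff.rfl

theorem head_nonneg {x : EuclideanSpace ℝ (Fin (r + 1))} (hx : x ∈ soc r) : 0 ≤ x 0 :=
  (norm_nonneg _).trans hx

/-- One inclusion is Cauchy-Schwarz for the tails; the other tests `y` against the axis and against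
the boundary vector `(‖ȳ‖; -ȳ)`. -/
theorem isSelfDual_soc (r : ℕ) : IsSelfDual (soc r) := by
  intro y
  refine ⟨fun hy x hx => ?_, fun h => ?_⟩
  · rw [inner_eq_head_tail]
    have h1 := abs_real_inner_le_norm (tail x) (tail y)
    have h2 := mul_le_mul (mem_soc.mp hx) (mem_soc.mp hy) (norm_nonneg _) (head_nonneg hx)
    linarith [neg_abs_le (inner ℝ (tail x) (tail y))]
  · have h0 : 0 ≤ y 0 := by
      have := h (ofHeadTail 1 0) (by simp [mem_soc])
      simpa [inner_eq_head_tail] using this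
    have h1 := h (ofHeadTail ‖tail y‖ (-tail y)) (by simp [mem_soc])
    rw [inner_eq_head_tail] at h1
    simp only [ofHeadTail_zero, tail_ofHeadTail, inner_neg_left, real_inner_self_eq_norm_sq] at h1
    rw [mem_soc]
    by_contra hlt
    push Not at hlt
    nlinarith

theorem axis_mem_soc : ofHeadTail 1 (0 : EuclideanSpace ℝ (Fin r)) ∈ soc r := by simp [mem_soc]

theorem norm_le_inner_axis : ∀ y ∈ soc r,
    (1 / 2) * ‖y‖ ≤ inner ℝ (ofHeadTail 1 (0 : EuclideanSpace ℝ (Fin r))) y := by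
  intro y hy
  have h0 := head_nonneg hy
  have h1 := norm_sq_eq_head_tail y
  have h2 := pow_le_pow_left₀ (norm_nonneg _) (mem_soc.mp hy) 2
  have h3 : ‖y‖ ≤ 2 * y 0 := by
    refine abs_le_of_sq_le_sq' ?_ (by linarith) |>.2
    nlinarith
  simp only [inner_eq_head_tail, ofHeadTail_zero, tail_ofHeadTail, inner_zero_left]
  linarith

/-- Complementary elements of the second-order cone have vanishing Jordan product. -/
theorem head_smul_tail_add_eq_zero {x y : EuclideanSpace ℝ (Fin (r + 1))} (hx : x ∈ soc r)
    (hy : y ∈ soc r) (hxy : inner ℝ x y = (0 : ℝ)) : x 0 • tail y + y 0 • tail x = 0 := by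
  rw [inner_eq_head_tail] at hxy
  have hx0 := head_nonneg hx
  have hy0 := head_nonneg hy
  have h1 := pow_le_pow_left₀ (norm_nonneg _) (mem_soc.mp hx) 2
  have h2 := pow_le_pow_left₀ (norm_nonneg _) (mem_soc.mp hy) 2
  have h : ‖x 0 • tail y + y 0 • tail x‖ ^ 2 ≤ 0 := by
    rw [norm_add_sq_real, norm_smul, norm_smul, real_inner_smul_left, real_inner_smul_right,
      mul_pow, mul_pow, Real.norm_eq_abs, Real.norm_eq_abs, sq_abs, sq_abs, real_inner_comm]
    have h3 : inner ℝ (tail x) (tail y) = -(x 0 * y 0) := by linarith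
    rw [h3]
    nlinarith [mul_le_mul_of_nonneg_left h1 (sq_nonneg (y 0)),
      mul_le_mul_of_nonneg_left h2 (sq_nonneg (x 0))]
  have : ‖x 0 • tail y + y 0 • tail x‖ = 0 := by
    nlinarith [norm_nonneg (x 0 • tail y + y 0 • tail x)]
  exact norm_eq_zero.mp this

/-- Pairing the vanishing Jordan product with `tail x` gives `ẏ ‖x̄‖² = ẏ ẋ²`: a vector with a
nonzero complementary partner lies on the boundary. -/
theorem norm_tail_eq_head {x y : EuclideanSpace ℝ (Fin (r + 1))} (hx : x ∈ soc r)
    (hy : y ∈ soc r) (hxy : inner ℝ x y = (0 : ℝ)) (hy0 : 0 < y 0) : ‖tail x‖ = x 0 := by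
  have h := congrArg (fun w => inner ℝ (tail x) w) (head_smul_tail_add_eq_zero hx hy hxy)
  simp only [inner_add_right, real_inner_smul_right, real_inner_self_eq_norm_sq,
    inner_zero_right] at h
  rw [inner_eq_head_tail] at hxy
  have h1 : y 0 * ‖tail x‖ ^ 2 = y 0 * x 0 ^ 2 := by
    have : inner ℝ (tail x) (tail y) = -(x 0 * y 0) := by linarith
    rw [this] at h
    linarith
  exact (sq_eq_sq₀ (norm_nonneg _) (head_nonneg hx)).mp (mul_left_cancel₀ hy0.ne' h1)

/-- The vanishing Jordan product is solved for `tail y`: the only complementary direction at `x` is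
its reflection. -/
theorem tail_eq_of_comp {x y : EuclideanSpace ℝ (Fin (r + 1))} (hx : x ∈ soc r)
    (hy : y ∈ soc r) (hxy : inner ℝ x y = (0 : ℝ)) (hx0 : 0 < x 0) :
    y = (y 0 / x 0) • ofHeadTail (x 0) (-tail x) := by
  have h := head_smul_tail_add_eq_zero hx hy hxy
  refine ext_head_tail ?_ ?_
  · simp [hx0.ne']
  · rw [tail_smul, tail_ofHeadTail]
    have h' : x 0 • tail y = -(y 0 • tail x) := eq_neg_of_add_eq_zero_left h
    rw [div_eq_inv_mul, mul_smul, smul_neg, ← h', inv_smul_smul₀ hx0.ne']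

/-- At `(z, 0)` with `z = (1; u)` and `z̃ = (1; -u)`, the first term is nonpositive because `z̃` is
in the dual cone and orthogonal to `z`. Near this point `y'` is a small multiple of the reflection
of `x'`, and reflection is an isometry taking `z` to `z̃`; so `⟨q, y'⟩` exceeds a nonpositive
multiple of `⟨q, z̃⟩` only by a product of two small quantities. -/
theorem compNormal_soc_edge {u : EuclideanSpace ℝ (Fin r)} (hu : ‖u‖ = 1) {α : ℝ} (hα : 0 ≤ α)
    {q : EuclideanSpace ℝ (Fin (r + 1))} (hq : inner ℝ q (ofHeadTail 1 (-u)) ≤ 0) :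
    CompNormal (soc r) (-α • ofHeadTail 1 (-u)) q (ofHeadTail 1 u) 0 := by
  intro ε hε
  refine ⟨min (1 / 2) (ε / (2 * ‖q‖ + 1)), by positivity, fun x' hx' y' hy' h0 hx hy => ?_⟩
  rw [lt_min_iff] at hx hy
  rw [sub_zero] at hy
  have hx0 : 1 / 2 ≤ x' 0 := by
    have := (abs_head_le_norm (x' - ofHeadTail 1 u)).trans hx.1.le
    have h2 := (abs_le.mp this).1
    simp only [PiLp.sub_apply, ofHeadTail_zero] at h2
    linarith
  have hzt : ofHeadTail 1 (-u) ∈ soc r := by simp [mem_soc, hu]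
  have hfst : inner ℝ (-α • ofHeadTail 1 (-u)) (x' - ofHeadTail 1 u) ≤ 0 := by
    have h1 := (isSelfDual_soc r).inner_nonneg hzt hx'
    have h2 : inner ℝ (ofHeadTail 1 (-u)) (ofHeadTail 1 u) = (0 : ℝ) := by
      simp [inner_eq_head_tail, hu]
    rw [inner_smul_left, inner_sub_right, h2]
    simp only [neg_mul, map_neg, conj_trivial, sub_zero]
    nlinarith
  have hy0 := head_nonneg hy'
  have hyn : y' 0 ≤ ‖y'‖ := (le_abs_self _).trans (abs_head_le_norm y')
  have hd : ‖ofHeadTail (x' 0) (-tail x') - ofHeadTail 1 (-u)‖ = ‖x' - ofHeadTail 1 u‖ := by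
    have : ‖ofHeadTail (x' 0) (-tail x') - ofHeadTail 1 (-u)‖ ^ 2 = ‖x' - ofHeadTail 1 u‖ ^ 2 := by
      rw [norm_sq_eq_head_tail, norm_sq_eq_head_tail]
      simp only [PiLp.sub_apply, ofHeadTail_zero, tail_sub, tail_ofHeadTail]
      rw [← neg_sub', norm_neg]
    exact (sq_eq_sq₀ (norm_nonneg _) (norm_nonneg _)).mp this
  have hsnd : inner ℝ q (y' - 0) ≤ ε * ‖x' - ofHeadTail 1 u‖ := by
    have h1 : inner ℝ q (ofHeadTail (x' 0) (-tail x')) ≤ ‖q‖ * ‖x' - ofHeadTail 1 u‖ := by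
      have h2 := real_inner_le_norm q (ofHeadTail (x' 0) (-tail x') - ofHeadTail 1 (-u))
      rw [hd, inner_sub_right] at h2
      linarith
    rw [sub_zero, tail_eq_of_comp hx' hy' h0 (by linarith), inner_smul_right]
    have h3 : y' 0 / x' 0 ≤ 2 * y' 0 := by
      rw [div_le_iff₀ (by linarith)]; nlinarith
    have h4 : 0 ≤ y' 0 / x' 0 := div_nonneg hy0 (by linarith)
    have h5 : y' 0 / x' 0 * inner ℝ q (ofHeadTail (x' 0) (-tail x')) ≤
        y' 0 / x' 0 * (‖q‖ * ‖x' - ofHeadTail 1 u‖) := mul_le_mul_of_nonneg_left h1 h4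
    have h6 : y' 0 / x' 0 * (‖q‖ * ‖x' - ofHeadTail 1 u‖) ≤
        2 * y' 0 * (‖q‖ * ‖x' - ofHeadTail 1 u‖) := mul_le_mul_of_nonneg_right h3 (by positivity)
    have h7 : y' 0 * (2 * ‖q‖ + 1) ≤ ε := by
      rw [← le_div_iff₀ (by positivity)]; linarith [hy.2]
    have h8 : 2 * y' 0 * ‖q‖ ≤ ε := by nlinarith
    nlinarith [norm_nonneg (x' - ofHeadTail 1 u), mul_le_mul_of_nonneg_right h8
      (norm_nonneg (x' - ofHeadTail 1 u))]
  have : 0 ≤ ε * ‖y' - 0‖ := by positivity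
  linarith

/-- For `w` on the boundary, `‖w̄ - ẇ u‖² = 2 ẇ (ẇ - ⟨u, w̄⟩)`, and `w̄ - ẇ u` is at most twice the
distance of `w` from any point of the line through `(1; u)`. The deviation is thus of second order.
-/
theorem head_sub_inner_le {u : EuclideanSpace ℝ (Fin r)} (hu : ‖u‖ = 1)
    {w : EuclideanSpace ℝ (Fin (r + 1))} (hw : ‖tail w‖ = w 0) (t : ℝ) :
    w 0 * |w 0 - inner ℝ u (tail w)| ≤ 2 * ‖w - t • ofHeadTail 1 u‖ ^ 2 := by
  have h1 : ‖tail w - w 0 • u‖ ^ 2 = 2 * (w 0 * (w 0 - inner ℝ u (tail w))) := by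
    rw [norm_sub_sq_real, norm_smul, hu, hw, real_inner_smul_right, real_inner_comm,
      Real.norm_eq_abs, mul_one, sq_abs]
    ring
  have h2 : tail w - w 0 • u = tail (w - t • ofHeadTail 1 u) - ((w - t • ofHeadTail 1 u) 0) • u := by
    simp only [tail_sub, tail_smul, tail_ofHeadTail, PiLp.sub_apply, PiLp.smul_apply,
      ofHeadTail_zero, smul_eq_mul, mul_one, sub_smul]
    abel
  have h3 : ‖tail w - w 0 • u‖ ≤ 2 * ‖w - t • ofHeadTail 1 u‖ := by
    rw [h2]
    refine (norm_sub_le _ _).trans ?_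
    rw [norm_smul, hu, mul_one, Real.norm_eq_abs]
    linarith [norm_tail_le_norm (w - t • ofHeadTail 1 u), abs_head_le_norm (w - t • ofHeadTail 1 u)]
  have hw0 : 0 ≤ w 0 := hw ▸ norm_nonneg _
  have h4 : 0 ≤ w 0 - inner ℝ u (tail w) := by
    have := real_inner_le_norm u (tail w)
    rw [hu, hw] at this
    linarith
  rw [abs_of_nonneg h4]
  nlinarith [norm_nonneg (tail w - w 0 • u), pow_le_pow_left₀ (norm_nonneg _) h3 2]

/-- The relation `a y = -b x` gives `a (s x + y) = (s a - b) x`. Both `s a - b` and `⟨h, x⟩` vanish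
at the reference point, so their product is of second order. Here `a`, `b` play the heads and `x`,
`y` the tails of a complementary pair. -/
theorem inner_tail_le_of_comp {x y h u : EuclideanSpace ℝ (Fin r)} {a b s δ X : ℝ} (hs : 0 < s)
    (hδ : 0 ≤ δ) (hX : 0 ≤ X) (hhu : inner ℝ h u = (0 : ℝ)) (ha : 1 / 2 ≤ a)
    (hj : a • y + b • x = 0) (hxX : ‖x - u‖ ≤ X) (ha' : |a - 1| ≤ δ) (hb' : |b - s| ≤ δ) :
    inner ℝ h (s • x + y) ≤ 2 * (s + 1) * ‖h‖ * δ * X := by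
  have e1 : a * inner ℝ h (s • x + y) = (s * a - b) * inner ℝ h x := by
    have : a • (s • x + y) = (s * a - b) • x := by
      rw [smul_add, eq_neg_of_add_eq_zero_left hj, sub_smul, smul_smul, mul_comm a s]
      abel
    rw [← real_inner_smul_right, this, real_inner_smul_right]
  have e2 : |inner ℝ h x| ≤ ‖h‖ * X := by
    have : inner ℝ h x = inner ℝ h (x - u) := by rw [inner_sub_right, hhu, sub_zero]
    rw [this]
    exact (abs_real_inner_le_norm _ _).trans (mul_le_mul_of_nonneg_left hxX (norm_nonneg _))
  have e3 : |s * a - b| ≤ (s + 1) * δ := by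
    have : s * a - b = s * (a - 1) - (b - s) := by ring
    rw [this]
    refine (abs_sub _ _).trans ?_
    rw [abs_mul, abs_of_pos hs]
    nlinarith
  have e4 : a * inner ℝ h (s • x + y) ≤ (s + 1) * δ * (‖h‖ * X) := by
    rw [e1]
    refine (le_abs_self _).trans ?_
    rw [abs_mul]
    exact mul_le_mul e3 e2 (abs_nonneg _) (by positivity)
  rcases le_or_gt (inner ℝ h (s • x + y)) 0 with hle | hgt
  · exact hle.trans (by positivity)
  · nlinarith

/-- Near a pair of nonzero complementary boundary vectors the complementarity set is smooth, and its
normals form a linear space, so `α` and `β` have no sign. Both vectors must stay on the boundary,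
which makes the `α` and `β` terms quadratic; the `h` term is quadratic by the Jordan relation. -/
theorem compNormal_soc_smooth {u h : EuclideanSpace ℝ (Fin r)} (hu : ‖u‖ = 1)
    (hh : inner ℝ h u = (0 : ℝ)) (α β : ℝ) {s : ℝ} (hs : 0 < s) :
    CompNormal (soc r) (α • ofHeadTail 1 (-u) + s • ofHeadTail 0 h)
      (β • ofHeadTail 1 u + ofHeadTail 0 h) (ofHeadTail 1 u) (s • ofHeadTail 1 (-u)) := by
  intro ε hε
  set C : ℝ := 4 * |α| + 4 * |β| / s + 2 * (s + 1) * ‖h‖ with hC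
  have hC0 : 0 ≤ C := by positivity
  obtain ⟨δ, hδ0, hδ1, hδ2, hδ4⟩ : ∃ δ : ℝ, 0 < δ ∧ δ ≤ 1 / 2 ∧ δ ≤ s / 2 ∧ δ ≤ ε / (C + 1) :=
    ⟨min (min (1 / 2) (s / 2)) (ε / (C + 1)), by positivity,
      (min_le_left _ _).trans (min_le_left _ _), (min_le_left _ _).trans (min_le_right _ _),
      min_le_right _ _⟩
  refine ⟨δ, hδ0, fun x' hx' y' hy' h0 hx hy => ?_⟩
  have hδ3 : C * δ ≤ ε := by
    have : δ * (C + 1) ≤ ε := by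
      rw [← le_div_iff₀ (by positivity)]; exact hδ4
    nlinarith
  set X := ‖x' - ofHeadTail 1 u‖ with hX
  set Y := ‖y' - s • ofHeadTail 1 (-u)‖ with hY
  have hX0 : 0 ≤ X := norm_nonneg _
  have hY0 : 0 ≤ Y := norm_nonneg _
  have hxh : |x' 0 - 1| ≤ X := by
    simpa using abs_head_le_norm (x' - ofHeadTail 1 u)
  have hyh : |y' 0 - s| ≤ Y := by
    simpa using abs_head_le_norm (y' - s • ofHeadTail 1 (-u))
  have hx1 : 1 / 2 ≤ x' 0 := by linarith [(abs_le.mp hxh).1]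
  have hy1 : s / 2 ≤ y' 0 := by linarith [(abs_le.mp hyh).1]
  have hxt : ‖tail x'‖ = x' 0 := norm_tail_eq_head hx' hy' h0 (by linarith)
  have hyt : ‖tail y'‖ = y' 0 :=
    norm_tail_eq_head hy' hx' (by rw [real_inner_comm]; exact h0) (by linarith)
  have b1 : |x' 0 - inner ℝ u (tail x')| ≤ 4 * δ * X := by
    have := head_sub_inner_le hu hxt 1
    rw [one_smul, ← hX] at this
    have h3 := mul_le_mul_of_nonneg_right hx1 (abs_nonneg (x' 0 - inner ℝ u (tail x')))
    nlinarith [mul_le_mul_of_nonneg_right hx.le hX0]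
  have b2 : |y' 0 + inner ℝ u (tail y')| ≤ 4 / s * δ * Y := by
    have := head_sub_inner_le (u := -u) (by rw [norm_neg, hu]) hyt s
    rw [inner_neg_left, sub_neg_eq_add, ← hY] at this
    have h3 := mul_le_mul_of_nonneg_right hy1 (abs_nonneg (y' 0 + inner ℝ u (tail y')))
    have h4 : s * |y' 0 + inner ℝ u (tail y')| ≤ 4 * δ * Y := by
      nlinarith [mul_le_mul_of_nonneg_right hy.le hY0]
    have h5 : 4 / s * δ * Y = (4 * δ * Y) / s := by ring
    rw [h5, le_div_iff₀ hs]
    linarith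
  have b3 : inner ℝ h (s • tail x' + tail y') ≤ 2 * (s + 1) * ‖h‖ * δ * X := by
    exact inner_tail_le_of_comp hs hδ0.le hX0 hh hx1 (head_smul_tail_add_eq_zero hx' hy' h0)
      (norm_tail_le_norm (x' - ofHeadTail 1 u)) (hxh.trans hx.le) (hyh.trans hy.le)
  -- The reference point contributes nothing, and the pairing splits into the three quantities
  -- bounded in `b1`, `b2` and `b3`.
  have expand : inner ℝ (α • ofHeadTail 1 (-u) + s • ofHeadTail 0 h) (x' - ofHeadTail 1 u) +
      inner ℝ (β • ofHeadTail 1 u + ofHeadTail 0 h) (y' - s • ofHeadTail 1 (-u)) =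
      α * (x' 0 - inner ℝ u (tail x')) + β * (y' 0 + inner ℝ u (tail y')) +
        inner ℝ h (s • tail x' + tail y') := by
    simp only [inner_add_left, inner_sub_right, inner_smul_left, inner_smul_right,
      inner_eq_head_tail, ofHeadTail_zero, tail_ofHeadTail, inner_neg_left, inner_neg_right, hh,
      real_inner_self_eq_norm_sq, hu, conj_trivial, inner_add_right]
    ring
  rw [expand]
  have c1 : α * (x' 0 - inner ℝ u (tail x')) ≤ |α| * (4 * δ * X) := by
    refine (le_abs_self _).trans ?_
    rw [abs_mul]
    gcongr
  have c2 : β * (y' 0 + inner ℝ u (tail y')) ≤ |β| * (4 / s * δ * Y) := by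
    refine (le_abs_self _).trans ?_
    rw [abs_mul]
    gcongr
  have hk1 : 0 ≤ |α| * (4 * δ * Y) := by positivity
  have hk2 : 0 ≤ |β| * (4 / s * δ * X) := by positivity
  have hk3 : 0 ≤ 2 * (s + 1) * ‖h‖ * δ * Y := by positivity
  have hsum : |α| * (4 * δ * X) + |β| * (4 / s * δ * Y) + 2 * (s + 1) * ‖h‖ * δ * X ≤
      C * δ * (X + Y) := by
    have : C * δ * (X + Y) = |α| * (4 * δ * X) + |β| * (4 / s * δ * Y) +
        2 * (s + 1) * ‖h‖ * δ * X + (|α| * (4 * δ * Y) + |β| * (4 / s * δ * X) +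
        2 * (s + 1) * ‖h‖ * δ * Y) := by
      rw [hC]; ring
    linarith
  have := mul_le_mul_of_nonneg_right hδ3 (add_nonneg hX0 hY0)
  linarith

end Soc

/-! ### The climbing property of the constraint blocks -/

section BlockClimb

variable {V : Type*} [AddCommGroup V] [Module ℝ V]
  {E : Type*} [NormedAddCommGroup E] [InnerProductSpace ℝ E]

/-- The functional `φ` has the form `A* p` with `p ∈ D^*N_K(0,0)(A ν)`. -/
def CoderivRel (K : Set E) (A : V →ₗ[ℝ] E) (ν : V) (φ : V →ₗ[ℝ] ℝ) : Prop :=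
  ∃ p ∈ coderivative (normalCone K) 0 0 (A ν), ∀ v, φ v = inner ℝ p (A v)

/-- The equation is linear in `(ν, p)`, so `ν` may be replaced by `-ν`; the coderivative inclusion
is needed for one of the two signs only. -/
theorem eq_zero_of_mem_coderivative_or {M : V →ₗ[ℝ] V →ₗ[ℝ] ℝ} {K : Set E} {A : V →ₗ[ℝ] E}
    {U : Submodule ℝ V}
    (h : ∀ ν ∈ U, ∀ φ, CoderivRel K A ν φ → (∀ v ∈ U, M ν v + φ v = 0) → ν = 0)
    {ν : V} (hν : ν ∈ U) {p : E}
    (hp : p ∈ coderivative (normalCone K) 0 0 (A ν) ∨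
      -p ∈ coderivative (normalCone K) 0 0 (-A ν))
    (hM : ∀ v ∈ U, M ν v + inner ℝ p (A v) = 0) : ν = 0 := by
  rcases hp with hp | hp
  · exact h ν hν (innerₗ E p ∘ₗ A) ⟨p, hp, fun v => by simp⟩ (fun v hv => by simpa using hM v hv)
  · rw [← map_neg] at hp
    refine neg_eq_zero.mp (h (-ν) (U.neg_mem hν) (innerₗ E (-p) ∘ₗ A) ⟨-p, hp, fun v => by simp⟩
      fun v hv => ?_)
    have := hM v hv
    simp only [map_neg, LinearMap.neg_apply, LinearMap.comp_apply, innerₗ_apply_apply]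
    linarith

end BlockClimb

section BlockClimbNormed

variable {V : Type*} [NormedAddCommGroup V] [NormedSpace ℝ V] [FiniteDimensional ℝ V]

/-- The degenerate vector `ν` gives the multiplier `p = s A ν`, a nonnegative multiple of `A ν`.
Whichever of `±A ν` lies in `-K`, the corresponding pair is a normal at the origin itself. -/
theorem climbs_of_total {E : Type*} [NormedAddCommGroup E] [InnerProductSpace ℝ E] {K : Set E}
    (hK : IsSelfDual K) (htot : ∀ q : E, q ∈ K ∨ -q ∈ K)
    {M : V →ₗ[ℝ] V →ₗ[ℝ] ℝ} (hM : ∀ u v, M u v = M v u) (A : V →ₗ[ℝ] E) :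
    Climbs M (LinearMap.ker A) (CoderivRel K A) := by
  intro U hpos hsys
  by_contra hU
  obtain ⟨ν, hν, hne, s, hs, hMν⟩ := exists_degenerate_of_not_posOn hM U A hpos hU
  refine hne (eq_zero_of_mem_coderivative_or hsys hν (p := s • A ν) ?_ ?_)
  · rcases htot (A ν) with h | h
    · exact Or.inr (mem_coderivative_of_neg hK (by rw [neg_neg]; exact hK.smul_mem h hs)
        (by rwa [neg_neg]))
    · exact Or.inl (mem_coderivative_of_neg hK (by rw [← smul_neg]; exact hK.smul_mem h hs) h)
  · intro v hv
    rw [hMν v hv, real_inner_smul_left]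
    ring

/-- The projection of `ℝ^r` onto the orthogonal complement of the unit vector `u`. -/
def perpProj {r : ℕ} (u : EuclideanSpace ℝ (Fin r)) :
    EuclideanSpace ℝ (Fin r) →ₗ[ℝ] EuclideanSpace ℝ (Fin r) :=
  LinearMap.id - (innerₗ _ u).smulRight u

theorem perpProj_apply {r : ℕ} (u w : EuclideanSpace ℝ (Fin r)) :
    perpProj u w = w - (inner ℝ u w : ℝ) • u := by
  simp [perpProj]

theorem inner_perpProj_self {r : ℕ} {u : EuclideanSpace ℝ (Fin r)} (hu : ‖u‖ = 1)
    (w : EuclideanSpace ℝ (Fin r)) : inner ℝ (perpProj u w) u = (0 : ℝ) := by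
  rw [perpProj_apply, inner_sub_left, real_inner_smul_left, real_inner_self_eq_norm_sq, hu,
    real_inner_comm]
  ring

theorem inner_perpProj_comm {r : ℕ} (u w w' : EuclideanSpace ℝ (Fin r)) :
    inner ℝ (perpProj u w) w' = (inner ℝ w (perpProj u w') : ℝ) := by
  rw [perpProj_apply, perpProj_apply, inner_sub_left, inner_sub_right, real_inner_smul_left,
    real_inner_smul_right, real_inner_comm u w, mul_comm]

theorem perpProj_perpProj {r : ℕ} {u : EuclideanSpace ℝ (Fin r)} (hu : ‖u‖ = 1)
    (w : EuclideanSpace ℝ (Fin r)) : perpProj u (perpProj u w) = perpProj u w := by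
  rw [perpProj_apply u (perpProj u w), real_inner_comm, inner_perpProj_self hu, zero_smul, sub_zero]

theorem decompose_light {r : ℕ} {u : EuclideanSpace ℝ (Fin r)}
    (q : EuclideanSpace ℝ (Fin (r + 1))) :
    q = ((inner ℝ (ofHeadTail 1 u) q : ℝ) / 2) • ofHeadTail 1 u +
      ((inner ℝ (ofHeadTail 1 (-u)) q : ℝ) / 2) • ofHeadTail 1 (-u) +
      ofHeadTail 0 (perpProj u (tail q)) := by
  simp only [inner_eq_head_tail, ofHeadTail_zero, tail_ofHeadTail, inner_neg_left]
  refine ext_head_tail ?_ ?_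
  · simp; ring
  · simp only [tail_add, tail_smul, tail_ofHeadTail, perpProj_apply, one_mul]
    module

theorem inner_light_combination {r : ℕ} (u : EuclideanSpace ℝ (Fin r)) (a b : ℝ)
    (h : EuclideanSpace ℝ (Fin r)) (w : EuclideanSpace ℝ (Fin (r + 1))) :
    inner ℝ (a • ofHeadTail 1 u + b • ofHeadTail 1 (-u) + ofHeadTail 0 (perpProj u h)) w =
      a * inner ℝ (ofHeadTail 1 u) w + b * inner ℝ (ofHeadTail 1 (-u)) w +
        inner ℝ h (perpProj u (tail w)) := by
  rw [inner_add_left, inner_add_left, real_inner_smul_left, real_inner_smul_left,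
    inner_eq_head_tail (ofHeadTail 0 _) w, tail_ofHeadTail, ofHeadTail_zero, zero_mul, zero_add,
    inner_perpProj_comm]

/-- The map `y ↦ ȳ` as a linear map. -/
def tailₗ (r : ℕ) : EuclideanSpace ℝ (Fin (r + 1)) →ₗ[ℝ] EuclideanSpace ℝ (Fin r) where
  toFun := tail
  map_add' := tail_add
  map_smul' := tail_smul

/-- The coordinates of `A v` along the boundary rays `z = (1; u)`, `z̃ = (1; -u)` and orthogonally
to both are `ζ`, `ζt`, `η`. Starting from `ker A`, the constraints are dropped in the order `ζ`,
`η`, `ζt`. The constraints still in force leave free components of the multiplier, and in each stage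
these match the freedom of a known family of normals. -/
theorem climbs_soc_of_unit {r : ℕ} {u : EuclideanSpace ℝ (Fin r)} (hu : ‖u‖ = 1)
    {M : V →ₗ[ℝ] V →ₗ[ℝ] ℝ} (hM : ∀ u v, M u v = M v u)
    (A : V →ₗ[ℝ] EuclideanSpace ℝ (Fin (r + 1))) :
    Climbs M (LinearMap.ker A) (CoderivRel (soc r) A) := by
  intro U hpos hsys
  set z := ofHeadTail 1 u with hz
  set zt := ofHeadTail 1 (-u) with hzt
  have hzK : z ∈ soc r := by simp [hz, mem_soc, hu]
  have hztK : zt ∈ soc r := by simp [hzt, mem_soc, hu]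
  have hzzt : inner ℝ z zt = (0 : ℝ) := by simp [hz, hzt, inner_eq_head_tail, hu]
  have hzz : inner ℝ z z = (2 : ℝ) := by
    rw [hz, inner_eq_head_tail, tail_ofHeadTail, real_inner_self_eq_norm_sq, hu, ofHeadTail_zero]
    norm_num
  let ζ : V →ₗ[ℝ] ℝ := innerₗ _ z ∘ₗ A
  let ζt : V →ₗ[ℝ] ℝ := innerₗ _ zt ∘ₗ A
  let η : V →ₗ[ℝ] EuclideanSpace ℝ (Fin r) := perpProj u ∘ₗ tailₗ r ∘ₗ A
  have hζ : ∀ v, ζ v = inner ℝ z (A v) := fun v => by simp [ζ]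
  have hζt : ∀ v, ζt v = inner ℝ zt (A v) := fun v => by simp [ζt]
  have hη : ∀ v, η v = perpProj u (tail (A v)) := fun v => rfl
  have hA : ∀ v, A v = (ζ v / 2) • z + (ζt v / 2) • zt + ofHeadTail 0 (η v) := fun v => by
    rw [hζ, hζt, hη]; exact decompose_light (A v)
  have hinner : ∀ (a b : ℝ) h v, inner ℝ (a • z + b • zt + ofHeadTail 0 (perpProj u h)) (A v) =
      a * ζ v + b * ζt v + inner ℝ h (η v) := fun a b h v => by
    rw [hζ, hζt, hη]; exact inner_light_combination u a b h (A v)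
  have edge : ∀ {α : ℝ} (_ : 0 ≤ α) {q : EuclideanSpace ℝ (Fin (r + 1))},
      inner ℝ q zt ≤ 0 → -α • zt ∈ coderivative (normalCone (soc r)) 0 0 q := fun hα _ hq =>
    (compNormal_soc_edge hu hα hq).mem_coderivative (isSelfDual_soc r) hzK
      (isSelfDual_soc r).zero_mem (inner_zero_right _)
  have edge' : ∀ {α : ℝ} (_ : 0 ≤ α) {p : EuclideanSpace ℝ (Fin (r + 1))},
      inner ℝ p z ≤ 0 → p ∈ coderivative (normalCone (soc r)) 0 0 (-α • z) := fun hα p hp => by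
    have hu' : ‖-u‖ = 1 := by rw [norm_neg, hu]
    have := (compNormal_soc_edge hu' hα (q := p) (by rwa [neg_neg])).symm
    rw [neg_neg] at this
    exact this.mem_coderivative (isSelfDual_soc r)
      (isSelfDual_soc r).zero_mem hztK (inner_zero_left _)
  -- Here `A ν` is a multiple of `z`. The multiplier is free along `z̃` and `η`, and its `z`-product
  -- has the sign of `ζ ν`; it is a normal at the pair `(0, z̃)`.
  have step1 : PosOn M ((U ⊓ LinearMap.ker η) ⊓ LinearMap.ker ζt) := by
    by_contra hU
    obtain ⟨ν, hν, hne, s, hs, hMν⟩ := exists_degenerate_of_not_posOn hM _ ζ (by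
      rintro v ⟨⟨⟨h1, h2⟩, h3⟩, h4⟩ hne
      refine hpos v ⟨h1, ?_⟩ hne
      change η v = 0 at h2
      change ζt v = 0 at h3
      change ζ v = 0 at h4
      change A v = 0
      rw [hA, h2, h3, h4]
      simp only [zero_div, zero_smul, add_zero, zero_add]
      exact ext_head_tail rfl rfl) hU
    obtain ⟨c, hc⟩ := exists_inner_eq_of_ker (M ν + (s * ζ ν) • ζ) ζt (U ⊓ LinearMap.ker η)
      (fun v hv hv' => by
        have := hMν v ⟨hv, hv'⟩
        simp only [LinearMap.add_apply, LinearMap.smul_apply, smul_eq_mul, this]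
        simp; ring)
    obtain ⟨h, hh⟩ := exists_inner_eq_of_ker (M ν + (s * ζ ν) • ζ - c • ζt) η U
      (fun v hv hv' => by
        have := hc v ⟨hv, hv'⟩
        rw [LinearMap.sub_apply, this]
        simp; ring)
    refine hne (eq_zero_of_mem_coderivative_or hsys hν.1.1
      (p := (s * ζ ν) • z + (-c) • zt + ofHeadTail 0 (perpProj u (-h))) ?_ ?_)
    · have hq : A ν = (ζ ν / 2) • z := by
        have h2 := LinearMap.mem_ker.mp hν.1.2
        have h3 := LinearMap.mem_ker.mp hν.2
        rw [hA, h2, h3]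
        simp only [zero_div, zero_smul, add_zero, add_eq_left]
        exact ext_head_tail rfl rfl
      have hp : inner ℝ ((s * ζ ν) • z + (-c) • zt + ofHeadTail 0 (perpProj u (-h))) z =
          2 * (s * ζ ν) := by
        rw [inner_add_left, inner_add_left, real_inner_smul_left, real_inner_smul_left, hzz,
          real_inner_comm, hzzt, inner_eq_head_tail (ofHeadTail 0 _), hz, tail_ofHeadTail,
          tail_ofHeadTail, inner_perpProj_self hu]
        simp; ring
      rcases le_total (ζ ν) 0 with hle | hle
      · refine Or.inl ?_
        have : A ν = -(-ζ ν / 2) • z := by rw [hq]; congr 1; ring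
        rw [this]
        refine edge' (by linarith) ?_
        rw [hp]; nlinarith
      · refine Or.inr ?_
        have : -A ν = -(ζ ν / 2) • z := by rw [hq, neg_smul]
        rw [this]
        refine edge' (by linarith) ?_
        rw [inner_neg_left, hp]; nlinarith
    · intro v hv
      have := hh v hv
      simp only [LinearMap.sub_apply, LinearMap.add_apply, LinearMap.smul_apply, smul_eq_mul]
        at this
      rw [hinner, inner_neg_left]
      linarith
  -- Here `A ν` has no `z̃` product, and the multiplier has transversal part `s η ν` and a free
  -- multiple of `z̃`. For `s > 0` this is a normal at the smooth pair `(z, s z̃)`; for `s = 0` one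
  -- at `(z, 0)`.
  have step2 : PosOn M (U ⊓ LinearMap.ker ζt) := by
    by_contra hU
    obtain ⟨ν, hν, hne, s, hs, hMν⟩ := exists_degenerate_of_not_posOn hM _ η
      (by rwa [inf_right_comm]) hU
    obtain ⟨c, hc⟩ := exists_inner_eq_of_ker (M ν + s • (innerₗ _ (η ν) ∘ₗ η)) ζt U
      (fun v hv hv' => by
        have := hMν v ⟨hv, hv'⟩
        simp only [LinearMap.add_apply, LinearMap.smul_apply, smul_eq_mul, this]
        simp)
    have hζν : ζt ν = 0 := hν.2
    have hηp : perpProj u (η ν) = η ν := by rw [hη, perpProj_perpProj hu]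
    have hsm : ∀ (t : ℝ) (w : EuclideanSpace ℝ (Fin r)), ofHeadTail 0 (t • w) = t • ofHeadTail 0 w :=
      fun t w => ext_head_tail (by simp) rfl
    refine hne (eq_zero_of_mem_coderivative_or hsys hν.1
      (p := (0 : ℝ) • z + (-c) • zt + ofHeadTail 0 (perpProj u (s • η ν))) ?_ ?_)
    · rw [map_smul, hηp, hsm, zero_smul, zero_add]
      have hqz : inner ℝ (A ν) zt = (0 : ℝ) := by rw [real_inner_comm, ← hζt, hζν]
      rcases hs.eq_or_lt with rfl | hs
      · rw [zero_smul, add_zero]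
        rcases le_total 0 c with hc0 | hc0
        · exact Or.inl (edge hc0 hqz.le)
        · refine Or.inr ?_
          rw [← neg_smul]
          exact edge (by linarith) (by rw [inner_neg_left, hqz, neg_zero])
      · refine Or.inl ?_
        have hq := hA ν
        rw [hζν, zero_div, zero_smul, add_zero] at hq
        rw [hq]
        refine (compNormal_soc_smooth hu ?_ _ _ hs).mem_coderivative (isSelfDual_soc r) hzK
          ((isSelfDual_soc r).smul_mem hztK hs.le) ?_
        · rw [hη, inner_perpProj_self hu]
        · rw [real_inner_smul_right]
          exact mul_eq_zero_of_right _ hzzt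
    · intro v hv
      have := hc v hv
      simp only [LinearMap.add_apply, LinearMap.smul_apply, smul_eq_mul, LinearMap.comp_apply,
        innerₗ_apply_apply] at this
      rw [hinner, real_inner_smul_left]
      simp only [RCLike.inner_apply, conj_trivial] at this
      linarith
  by_contra hU
  -- Now `A ν` is unrestricted and the multiplier is a multiple of `z̃`, again a normal at `(z, 0)`
  -- after a choice of sign.
  obtain ⟨ν, hν, hne, s, hs, hMν⟩ := exists_degenerate_of_not_posOn hM _ ζt step2 hU
  refine hne (eq_zero_of_mem_coderivative_or hsys hν (p := (s * ζt ν) • zt) ?_ ?_)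
  · rcases le_total (ζt ν) 0 with hle | hle
    · refine Or.inl ?_
      rw [← neg_neg (s * ζt ν)]
      refine edge (by nlinarith) ?_
      rwa [real_inner_comm, ← hζt]
    · refine Or.inr ?_
      rw [← neg_smul]
      refine edge (by positivity) ?_
      rw [inner_neg_left, real_inner_comm, ← hζt]
      linarith
  · intro v hv
    rw [hMν v hv, real_inner_smul_left, ← hζt]
    simp; ring

theorem climbs_soc (r : ℕ) {M : V →ₗ[ℝ] V →ₗ[ℝ] ℝ} (hM : ∀ u v, M u v = M v u)
    (A : V →ₗ[ℝ] EuclideanSpace ℝ (Fin (r + 1))) :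
    Climbs M (LinearMap.ker A) (CoderivRel (soc r) A) := by
  cases r with
  | zero =>
    -- `ℝ^0` has no unit vector, but the cone is then a half-line.
    refine climbs_of_total (isSelfDual_soc 0) (fun q => ?_) hM A
    have : ∀ w : EuclideanSpace ℝ (Fin 0), ‖w‖ = 0 := fun w => by
      rw [Subsingleton.elim w 0, norm_zero]
    simp only [mem_soc, this, PiLp.neg_apply]
    rcases le_total 0 (q 0) with h | h
    · exact Or.inl h
    · exact Or.inr (by linarith)
  | succ r =>
    exact climbs_soc_of_unit (u := EuclideanSpace.single 0 1) (by simp) hM A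

theorem climbs_Ici {M : V →ₗ[ℝ] V →ₗ[ℝ] ℝ} (hM : ∀ u v, M u v = M v u) (A : V →ₗ[ℝ] ℝ) :
    Climbs M (LinearMap.ker A) (CoderivRel (Set.Ici (0 : ℝ)) A) :=
  climbs_of_total isSelfDual_Ici (fun q => by simpa using le_total 0 q) hM A

end BlockClimbNormed

/-! ### Second-order expansions along curves -/

section Taylor

variable {E : Type*} [NormedAddCommGroup E] [NormedSpace ℝ E]

/-- Subtracting the quadratic term leaves a function whose derivative at `y` is `o(‖y - x‖)`; the
mean value inequality on the ball of radius `‖y - x‖` gains one more order. -/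
theorem taylor_second_isLittleO {L : E → ℝ} (hL : ContDiff ℝ 2 L) {x : E}
    (h0 : fderiv ℝ L x = 0) :
    (fun y => L y - L x - (1 / 2) * fderiv ℝ (fderiv ℝ L) x (y - x) (y - x)) =o[𝓝 x]
      fun y => ‖y - x‖ ^ 2 := by
  set B := fderiv ℝ (fderiv ℝ L) x with hB
  have hsymm : ∀ u v, B u v = B v u := fun u v =>
    hL.contDiffAt.isSymmSndFDerivAt (by simp) u v
  have hd : DifferentiableAt ℝ (fderiv ℝ L) x :=
    ((hL.fderiv_right (m := 1) (by norm_num)).differentiable (by norm_num)) x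
  have hLd : Differentiable ℝ L := hL.differentiable (by norm_num)
  let ψ : E → ℝ := fun y => L y - (1 / 2) * B (y - x) (y - x)
  have hψ : ∀ y, HasFDerivAt ψ (fderiv ℝ L y - B (y - x)) y := by
    intro y
    have h1 : HasFDerivAt (fun y => y - x) (ContinuousLinearMap.id ℝ E) y :=
      (hasFDerivAt_id y).sub_const x
    have h2 : HasFDerivAt (fun y => B (y - x)) (B.comp (ContinuousLinearMap.id ℝ E)) y :=
      B.hasFDerivAt.comp y h1
    have h3 := (hLd y).hasFDerivAt.sub ((h2.clm_apply h1).const_mul (1 / 2))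
    refine h3.congr_fderiv ?_
    ext v
    simp [hsymm v]
    ring
  rw [Asymptotics.isLittleO_iff]
  intro c hc
  have h1 := (Asymptotics.isLittleO_iff.mp hd.hasFDerivAt.isLittleO) hc
  rw [h0] at h1
  obtain ⟨δ, hδ, H⟩ := Metric.eventually_nhds_iff_ball.mp h1
  filter_upwards [Metric.ball_mem_nhds x hδ] with y hy
  have hn : ‖y - x‖ < δ := by rwa [← dist_eq_norm]
  have hmv := Convex.norm_image_sub_le_of_norm_hasFDerivWithin_le (f := ψ)
    (f' := fun y => fderiv ℝ L y - B (y - x)) (s := Metric.closedBall x ‖y - x‖)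
    (C := c * ‖y - x‖) (x := x) (y := y) (fun w _ => (hψ w).hasFDerivWithinAt) ?_
    (convex_closedBall _ _) (by simp) (by simp [dist_eq_norm])
  · simp only [ψ, sub_self, map_zero, mul_zero, sub_zero] at hmv
    rw [norm_pow, norm_norm]
    have e : L y - L x - 1 / 2 * B (y - x) (y - x) = L y - 1 / 2 * B (y - x) (y - x) - L x := by
      ring
    rw [e]
    calc _ ≤ c * ‖y - x‖ * ‖y - x‖ := hmv
      _ = c * ‖y - x‖ ^ 2 := by ring
  · intro w hw
    rw [Metric.mem_closedBall] at hw
    have := H w (by rw [Metric.mem_ball]; exact hw.trans_lt hn)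
    rw [sub_zero] at this
    refine this.trans (mul_le_mul_of_nonneg_left ?_ hc.le)
    rwa [← dist_eq_norm]

/-- Because the gradient vanishes, first-order information on the curve suffices: its acceleration
does not enter the limit. -/
theorem tendsto_second_difference {L : E → ℝ} (hL : ContDiff ℝ 2 L) {x d : E}
    (h0 : fderiv ℝ L x = 0) {γ : ℝ → E} (hγ0 : γ 0 = x) (hγ : HasDerivAt γ d 0) :
    Tendsto (fun t => (t⁻¹) ^ 2 * (L (γ t) - L x)) (𝓝[≠] 0)
      (𝓝 ((1 / 2) * fderiv ℝ (fderiv ℝ L) x d d)) := by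
  set B := fderiv ℝ (fderiv ℝ L) x
  have hslope : Tendsto (fun t => t⁻¹ • (γ t - x)) (𝓝[≠] 0) (𝓝 d) := by
    have := hasDerivAt_iff_tendsto_slope.mp hγ
    refine this.congr fun t => ?_
    rw [slope_def_module, hγ0, sub_zero]
  have hγc : Tendsto γ (𝓝[≠] 0) (𝓝 x) := by
    have := hγ.continuousAt.tendsto
    rw [hγ0] at this
    exact this.mono_left nhdsWithin_le_nhds
  have ho := (taylor_second_isLittleO hL h0).comp_tendsto hγc
  have hO : (fun t => ‖γ t - x‖ ^ 2) =O[𝓝[≠] 0] fun t : ℝ => t ^ 2 := by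
    have h1 : (fun t => γ t - x) =O[𝓝 0] fun t : ℝ => t := by
      have := hγ.isBigO_sub
      simpa [hγ0] using this
    exact (h1.mono nhdsWithin_le_nhds).norm_left.pow 2
  have hlim := (ho.trans_isBigO hO).tendsto_div_nhds_zero
  have hquad : Tendsto (fun t => (1 / 2) * B (t⁻¹ • (γ t - x)) (t⁻¹ • (γ t - x))) (𝓝[≠] 0)
      (𝓝 ((1 / 2) * B d d)) := by
    refine Tendsto.const_mul _ ?_
    have hB : Continuous fun v => B v v := B.continuous.clm_apply continuous_id
    exact (hB.tendsto d).comp hslope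
  have := hlim.add hquad
  rw [zero_add] at this
  refine this.congr fun t => ?_
  simp only [Function.comp_apply, map_smul, smul_eq_mul, FunLike.coe_smul, Pi.smul_apply]
  ring

end Taylor

/-! ### Tangent directions and local parametrizations of the second-order cone -/

section SocLocal

variable {r : ℕ}

/-- `(ẏ; -ȳ)` as an element of Euclidean space. -/
def reflectE (y : EuclideanSpace ℝ (Fin (r + 1))) : EuclideanSpace ℝ (Fin (r + 1)) :=
  ofHeadTail (y 0) (-tail y)

theorem inner_reflectE (y w : EuclideanSpace ℝ (Fin (r + 1))) :
    inner ℝ (reflectE y) w = y 0 * w 0 - inner ℝ (tail y) (tail w) := by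
  rw [inner_eq_head_tail, reflectE, ofHeadTail_zero, tail_ofHeadTail, inner_neg_left]; ring

theorem reflectE_mem_soc {y : EuclideanSpace ℝ (Fin (r + 1))} (hy : y ∈ soc r) :
    reflectE y ∈ soc r := by
  rw [mem_soc] at hy ⊢
  simpa [reflectE] using hy

theorem inner_reflectE_self {y : EuclideanSpace ℝ (Fin (r + 1))} (hy : ‖tail y‖ = y 0) :
    inner ℝ (reflectE y) y = (0 : ℝ) := by
  rw [inner_reflectE, real_inner_self_eq_norm_sq, hy]; ring

theorem continuous_head : Continuous fun y : EuclideanSpace ℝ (Fin (r + 1)) => y 0 := by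
  fun_prop

theorem continuous_tail : Continuous (tail : EuclideanSpace ℝ (Fin (r + 1)) → _) :=
  (tailₗ r).continuous_of_finiteDimensional

theorem soc_mem_nhds {y : EuclideanSpace ℝ (Fin (r + 1))} (hy : ‖tail y‖ < y 0) :
    ∀ᶠ w in 𝓝 y, w ∈ soc r := by
  filter_upwards [(isOpen_lt continuous_tail.norm continuous_head).mem_nhds hy] with w hw
  exact le_of_lt hw

theorem mem_frontier_soc {y : EuclideanSpace ℝ (Fin (r + 1))} :
    y ∈ frontier (soc r) ↔ ‖tail y‖ = y 0 := by
  constructor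
  · intro h
    exact frontier_le_subset_eq continuous_tail.norm continuous_head h
  · intro h
    rw [frontier_eq_closure_inter_closure]
    refine ⟨subset_closure h.le, ?_⟩
    have hlim : Tendsto (fun k : ℕ => y + (-(1 / ((k : ℝ) + 1))) • ofHeadTail 1 0) atTop (𝓝 y) := by
      have := (tendsto_one_div_add_atTop_nhds_zero_nat (𝕜 := ℝ)).neg.smul_const
        (ofHeadTail 1 (0 : EuclideanSpace ℝ (Fin r)))
      rw [neg_zero, zero_smul] at this
      simpa using this.const_add y
    refine mem_closure_of_tendsto hlim (Eventually.of_forall fun k => ?_)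
    have : 0 < 1 / ((k : ℝ) + 1) := by positivity
    simp only [Set.mem_compl_iff, mem_soc, tail_add, tail_smul, tail_ofHeadTail, smul_zero,
      add_zero, PiLp.add_apply, PiLp.smul_apply, ofHeadTail_zero, smul_eq_mul, not_le, h]
    linarith

theorem eq_zero_of_inner_eq_zero {y m : EuclideanSpace ℝ (Fin (r + 1))} (hy : y ∈ soc r)
    (hm : ‖tail m‖ < m 0) (h : inner ℝ y m = (0 : ℝ)) : y = 0 := by
  have hj := head_smul_tail_add_eq_zero (hm.le : m ∈ soc r) hy (by rw [real_inner_comm]; exact h)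
  by_cases h0 : 0 < y 0
  · exact absurd (norm_tail_eq_head hm.le hy (by rw [real_inner_comm]; exact h) h0) hm.ne
  · have h0' : y 0 = 0 := le_antisymm (not_lt.mp h0) (head_nonneg hy)
    refine ext_head_tail (by simpa using h0') ?_
    rw [mem_soc, h0'] at hy
    rw [tail_zero]
    exact norm_le_zero_iff.mp hy

theorem head_pos_of_ne_zero {y : EuclideanSpace ℝ (Fin (r + 1))} (hy : y ∈ soc r) (h : y ≠ 0) :
    0 < y 0 := by
  refine lt_of_le_of_ne (head_nonneg hy) fun h0 => h (ext_head_tail (by simp [← h0]) ?_)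
  rw [mem_soc, ← h0] at hy
  rw [tail_zero]
  exact norm_le_zero_iff.mp hy

/-- Directions in the dual of the face normal to `g` become feasible after a perturbation along
the axis. -/
theorem eventually_add_smul_mem_soc {g v : EuclideanSpace ℝ (Fin (r + 1))} (hg : g ∈ soc r)
    (hv : ∀ m ∈ soc r, inner ℝ m g = (0 : ℝ) → 0 ≤ (inner ℝ m v : ℝ)) {ε : ℝ} (hε : 0 < ε) :
    ∀ᶠ t in 𝓝[>] (0 : ℝ), g + t • (v + ε • ofHeadTail 1 0) ∈ soc r := by
  set w := v + ε • ofHeadTail 1 (0 : EuclideanSpace ℝ (Fin r)) with hw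
  have hcont : Tendsto (fun t : ℝ => g + t • w) (𝓝[>] 0) (𝓝 g) := by
    have : Tendsto (fun t : ℝ => g + t • w) (𝓝 0) (𝓝 (g + (0 : ℝ) • w)) :=
      Continuous.tendsto (by fun_prop) 0
    rw [zero_smul, add_zero] at this
    exact this.mono_left nhdsWithin_le_nhds
  by_cases hg0 : g = 0
  · have hvK : v ∈ soc r := (isSelfDual_soc r v).mpr fun m hm => hv m hm (by simp [hg0])
    have hwK : w ∈ soc r :=
      (isSelfDual_soc r).add_mem hvK ((isSelfDual_soc r).smul_mem axis_mem_soc hε.le)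
    filter_upwards [self_mem_nhdsWithin] with t ht
    rw [hg0, zero_add]
    exact (isSelfDual_soc r).smul_mem hwK (le_of_lt ht)
  rcases (mem_soc.mp hg).lt_or_eq with hlt | heq
  · exact hcont.eventually (soc_mem_nhds hlt)
  · have hgpos := head_pos_of_ne_zero hg hg0
    have h1 : 0 < (inner ℝ (reflectE g) w : ℝ) := by
      have h2 := hv _ (reflectE_mem_soc hg) (inner_reflectE_self heq)
      rw [hw, inner_add_right, real_inner_smul_right, inner_reflectE g (ofHeadTail 1 0)]
      simp only [ofHeadTail_zero, tail_ofHeadTail, inner_zero_right]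
      have : 0 < ε * (g 0 * 1 - 0) := by
        rw [mul_one, sub_zero]; positivity
      linarith
    -- For `g` on the boundary, `t` times this expression is the squared head minus the squared tail
    -- norm of `g + t • w`.
    have h3 : ∀ᶠ t in 𝓝[>] (0 : ℝ), 0 < 2 * (inner ℝ (reflectE g) w : ℝ) +
        t * (w 0 ^ 2 - ‖tail w‖ ^ 2) := by
      have : Tendsto (fun t : ℝ => 2 * (inner ℝ (reflectE g) w : ℝ) +
          t * (w 0 ^ 2 - ‖tail w‖ ^ 2)) (𝓝 0) (𝓝 (2 * (inner ℝ (reflectE g) w : ℝ) +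
          0 * (w 0 ^ 2 - ‖tail w‖ ^ 2))) := Continuous.tendsto (by fun_prop) 0
      refine (this.mono_left nhdsWithin_le_nhds).eventually_const_lt ?_
      linarith
    have h4 : ∀ᶠ t in 𝓝[>] (0 : ℝ), 0 < (g + t • w) 0 :=
      ((continuous_head.tendsto g).comp hcont).eventually_const_lt hgpos
    filter_upwards [h3, h4, self_mem_nhdsWithin] with t h3 h4 ht
    rw [mem_soc]
    refine abs_le_of_sq_le_sq' ?_ h4.le |>.2
    rw [tail_add, tail_smul, norm_add_sq_real, norm_smul, mul_pow, Real.norm_eq_abs, sq_abs,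
      real_inner_smul_right, heq]
    simp only [PiLp.add_apply, PiLp.smul_apply, smul_eq_mul]
    rw [inner_reflectE] at h3
    have := mul_pos (Set.mem_Ioi.mp ht) h3
    nlinarith

/-- Differentiating `‖y‖ * ‖y‖ = ‖y‖ ^ 2` in two ways. -/
theorem fderiv_norm_apply {F : Type*} [NormedAddCommGroup F] [InnerProductSpace ℝ F] {x : F}
    (hx : x ≠ 0) (s : F) : ‖x‖ * fderiv ℝ (fun y : F => ‖y‖) x s = inner ℝ x s := by
  have h1 : HasFDerivAt (fun y : F => ‖y‖) (fderiv ℝ (fun y : F => ‖y‖) x) x :=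
    ((contDiffAt_norm ℝ hx).differentiableAt (n := 1) (by norm_num)).hasFDerivAt
  have h2 := (h1.mul h1).unique
    ((hasStrictFDerivAt_norm_sq x).hasFDerivAt.congr_of_eventuallyEq
      (Eventually.of_forall fun y => (sq ‖y‖).symm))
  have := congrArg (fun f : F →L[ℝ] ℝ => f s) h2
  simp at this
  linarith

/-- A local parametrization of the face of the second-order cone around `g` of the same type. -/
theorem exists_local_parametrization {g : EuclideanSpace ℝ (Fin (r + 1))} (hg : g ∈ soc r) :
    ∃ (φ : EuclideanSpace ℝ (Fin (r + 1)) → EuclideanSpace ℝ (Fin (r + 1)))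
      (φ' : EuclideanSpace ℝ (Fin (r + 1)) →L[ℝ] EuclideanSpace ℝ (Fin (r + 1))),
      HasStrictFDerivAt φ φ' 0 ∧ φ 0 = g ∧
      (∀ s, (∀ m ∈ soc r, inner ℝ m g = (0 : ℝ) → inner ℝ m s = (0 : ℝ)) → φ' s = s) ∧
      ∀ᶠ v in 𝓝 0, φ v ∈ soc r ∧ (g = 0 → φ v = 0) ∧ (‖tail g‖ = g 0 → ‖tail (φ v)‖ = φ v 0) := by
  by_cases hg0 : g = 0
  · subst hg0
    refine ⟨fun _ => 0, 0, hasStrictFDerivAt_const _ _, rfl, fun s hs => ?_,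
      Eventually.of_forall fun v => ⟨(isSelfDual_soc r).zero_mem, fun _ => rfl, fun _ => by simp [tail_zero]⟩⟩
    -- A vector orthogonal to the whole cone lies in the dual, that is, in the cone, hence is
    -- orthogonal to itself.
    have h1 : s ∈ soc r := (isSelfDual_soc r s).mpr fun m hm => (hs m hm (by simp)).ge
    have h2 := hs s h1 (by simp)
    exact (inner_self_eq_zero.mp h2).symm
  rcases (mem_soc.mp hg).lt_or_eq with hlt | heq
  · refine ⟨fun v => g + v, ContinuousLinearMap.id ℝ _, (hasStrictFDerivAt_id _).const_add g,
      add_zero g, fun s _ => rfl, ?_⟩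
    have : Tendsto (fun v => g + v) (𝓝 0) (𝓝 g) := by
      have : Tendsto (fun v => g + v) (𝓝 0) (𝓝 (g + 0)) := Continuous.tendsto (by fun_prop) 0
      rwa [add_zero] at this
    filter_upwards [this.eventually (soc_mem_nhds hlt)] with v hv
    exact ⟨hv, fun h => absurd h hg0, fun h => absurd h hlt.ne⟩
  · have hgpos := head_pos_of_ne_zero hg hg0
    have htg : tail g ≠ 0 := by
      rw [← norm_pos_iff, heq]; exact hgpos
    let T : EuclideanSpace ℝ (Fin (r + 1)) →L[ℝ] EuclideanSpace ℝ (Fin r) :=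
      LinearMap.toContinuousLinearMap (tailₗ r)
    let O : (ℝ × EuclideanSpace ℝ (Fin r)) →L[ℝ] EuclideanSpace ℝ (Fin (r + 1)) :=
      LinearMap.toContinuousLinearMap
        { toFun := fun p => ofHeadTail p.1 p.2
          map_add' := fun p q => ext_head_tail rfl rfl
          map_smul' := fun c p => ext_head_tail rfl rfl }
    let N : EuclideanSpace ℝ (Fin r) →L[ℝ] ℝ := fderiv ℝ (fun y => ‖y‖) (tail g)
    have hT : HasStrictFDerivAt (fun v => tail g + T v) T 0 := T.hasStrictFDerivAt.const_add _
    have hN : HasStrictFDerivAt (fun y : EuclideanSpace ℝ (Fin r) => ‖y‖) N (tail g + T 0) := by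
      rw [map_zero, add_zero]
      exact (contDiffAt_norm ℝ htg).hasStrictFDerivAt (n := 1) (by norm_num)
    -- The boundary is parametrized by the tail: `v ↦ (‖ḡ + v̄‖; ḡ + v̄)`, smooth because `ḡ ≠ 0`.
    have hφ := O.hasStrictFDerivAt.comp (0 : EuclideanSpace ℝ (Fin (r + 1)))
      ((hN.comp (0 : EuclideanSpace ℝ (Fin (r + 1))) hT).prodMk hT)
    refine ⟨_, _, hφ, ?_, fun s hs => ?_, Eventually.of_forall fun v => ?_⟩
    · refine ext_head_tail ?_ ?_
      · change ‖tail g + T 0‖ = g 0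
        rw [map_zero, add_zero, heq]
      · change tail g + T 0 = tail g
        rw [map_zero, add_zero]
    · refine ext_head_tail ?_ rfl
      change N (tail s) = s 0
      have h1 := hs _ (reflectE_mem_soc hg) (inner_reflectE_self heq)
      have h2 := fderiv_norm_apply htg (tail s)
      rw [inner_reflectE] at h1
      rw [heq] at h2
      change g 0 * N (tail s) = _ at h2
      have : g 0 * N (tail s) = g 0 * s 0 := by linarith
      exact mul_left_cancel₀ hgpos.ne' this
    · refine ⟨?_, fun h => absurd h hg0, fun _ => rfl⟩
      change ‖tail g + T v‖ ≤ ‖tail g + T v‖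
      exact le_rfl

end SocLocal

namespace Problem

/-! ### Tangent cone, critical cone and second-order necessary condition -/

variable {n m J : ℕ} {r : Fin J → ℕ} (P : Problem n m J r) (x : EuclideanSpace ℝ (Fin n))

/-- Membership in the largest subspace contained in the tangent cone, expressed by duality. -/
def IsLineal (v : ConstraintSpace m J r) : Prop :=
  v.1 = 0 ∧ ∀ j, ∀ w ∈ soc (r j), inner ℝ w (P.g j x) = (0 : ℝ) → inner ℝ w (v.2 j) = (0 : ℝ)

variable {P x}

/-- A tangent direction satisfies the dual inequalities by passing to the limit. Conversely, such a
direction perturbed along the axes of the cones is feasible for small steps, and the tangent cone is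
closed. -/
theorem mem_tangentK_iff (hx : x ∈ P.feasible) {v : ConstraintSpace m J r} :
    v ∈ P.tangentK x ↔ v.1 = 0 ∧ ∀ j, ∀ w ∈ soc (r j), inner ℝ w (P.g j x) = (0 : ℝ) →
      0 ≤ (inner ℝ w (v.2 j) : ℝ) := by
  constructor
  · intro hv
    obtain ⟨α, l, hl, c, d, -, hmem, hlim⟩ := exists_fun_of_mem_tangentConeAt hv
    refine ⟨?_, fun j w hw hwg => ?_⟩
    · have h1 : Tendsto (fun n => (c n • d n).1) l (𝓝 v.1) := (continuous_fst.tendsto v).comp hlim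
      refine tendsto_nhds_unique h1 (tendsto_const_nhds.congr' ?_)
      filter_upwards [hmem] with k hk
      have h2 := hk.1
      have h3 : (P.G x).1 = 0 := hx.1
      rw [Prod.fst_add, h3, zero_add] at h2
      rw [Prod.smul_fst, h2, smul_zero]
    · have h1 : Tendsto (fun n => (inner ℝ w ((c n • d n).2 j) : ℝ)) l (𝓝 (inner ℝ w (v.2 j))) := by
        have hc : Continuous fun y : ConstraintSpace m J r => (inner ℝ w (y.2 j) : ℝ) := by
          fun_prop
        exact (hc.tendsto v).comp hlim
      refine ge_of_tendsto h1 ?_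
      filter_upwards [hmem] with k hk
      have h2 := (isSelfDual_soc (r j)).inner_nonneg hw (hk.2 j)
      have h3 : (P.G x + d k).2 j = P.g j x + (d k).2 j := rfl
      rw [h3, inner_add_right, hwg, zero_add] at h2
      have h4 : (c k • d k).2 j = (c k : ℝ) • (d k).2 j := rfl
      rw [h4, real_inner_smul_right]
      exact mul_nonneg (c k).2 h2
  · rintro ⟨h1, h2⟩
    let e : ConstraintSpace m J r := (0, fun j => ofHeadTail 1 0)
    have hcl : IsClosed (P.tangentK x) := by
      rw [tangentK, tangentConeAt_def]
      exact isClosed_setOfPred_clusterPt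
    have hstep : ∀ ε : ℝ, 0 < ε → v + ε • e ∈ P.tangentK x := by
      intro ε hε
      refine mem_tangentConeAt_of_seq (𝓝[>] (0 : ℝ)) (fun t => Real.toNNReal t⁻¹)
        (fun t => t • (v + ε • e)) ?_ ?_ ?_
      · have : Tendsto (fun t : ℝ => t • (v + ε • e)) (𝓝 0) (𝓝 ((0 : ℝ) • (v + ε • e))) :=
          Continuous.tendsto (by fun_prop) 0
        rw [zero_smul] at this
        exact this.mono_left nhdsWithin_le_nhds
      · have hall : ∀ᶠ t in 𝓝[>] (0 : ℝ), ∀ j,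
            P.g j x + t • (v.2 j + ε • ofHeadTail 1 0) ∈ soc (r j) :=
          eventually_all.mpr fun j => eventually_add_smul_mem_soc (hx.2 j) (h2 j) hε
        filter_upwards [hall] with t ht
        refine ⟨?_, fun j => ht j⟩
        change (P.G x).1 + t • (v.1 + ε • (0 : EuclideanSpace ℝ (Fin m))) = 0
        rw [h1, smul_zero, add_zero, smul_zero, add_zero]
        exact hx.1
      · refine tendsto_const_nhds.congr' ?_
        filter_upwards [self_mem_nhdsWithin] with t ht
        have ht' : (0 : ℝ) < t := ht
        rw [NNReal.smul_def, Real.coe_toNNReal _ (by positivity), inv_smul_smul₀ ht'.ne']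
    have hlim : Tendsto (fun ε : ℝ => v + ε • e) (𝓝[>] 0) (𝓝 v) := by
      have : Tendsto (fun t : ℝ => v + t • e) (𝓝 0) (𝓝 (v + (0 : ℝ) • e)) :=
        Continuous.tendsto (by fun_prop) 0
      rw [zero_smul, add_zero] at this
      exact this.mono_left nhdsWithin_le_nhds
    refine hcl.mem_of_tendsto hlim ?_
    filter_upwards [self_mem_nhdsWithin] with ε hε
    exact hstep ε hε

theorem isLineal_of_mem_linealitySpace (hx : x ∈ P.feasible) {v : ConstraintSpace m J r}
    (hv : v ∈ linealitySpace (P.tangentK x)) : P.IsLineal x v := by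
  let L : Submodule ℝ (ConstraintSpace m J r) :=
    { carrier := {v | P.IsLineal x v}
      zero_mem' := ⟨rfl, fun j w _ _ => inner_zero_right _⟩
      add_mem' := fun {a b} ha hb => ⟨by rw [Prod.fst_add, ha.1, hb.1, add_zero],
        fun j w hw h0 => by
          rw [Prod.snd_add, Pi.add_apply, inner_add_right, ha.2 j w hw h0, hb.2 j w hw h0,
            add_zero]⟩
      smul_mem' := fun c a ha => ⟨by rw [Prod.smul_fst, ha.1, smul_zero],
        fun j w hw h0 => by
          rw [Prod.smul_snd, Pi.smul_apply, real_inner_smul_right, ha.2 j w hw h0, mul_zero]⟩ }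
  suffices linealitySpace (P.tangentK x) ≤ L from this hv
  refine sSup_le fun S hS u hu => ?_
  have h1 := (mem_tangentK_iff hx).mp (hS hu)
  have h2 := (mem_tangentK_iff hx).mp (hS (S.neg_mem hu))
  refine ⟨h1.1, fun j w hw h0 => le_antisymm ?_ (h1.2 j w hw h0)⟩
  have := h2.2 j w hw h0
  rw [Prod.snd_neg, Pi.neg_apply, inner_neg_right] at this
  linarith

theorem hasStrictFDerivAt_G (P : Problem n m J r) (x : EuclideanSpace ℝ (Fin n)) :
    HasStrictFDerivAt P.G ((fderiv ℝ P.h x).prod (ContinuousLinearMap.pi fun j =>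
      fderiv ℝ (P.g j) x)) x :=
  (P.contDiff_h.contDiffAt.hasStrictFDerivAt (by norm_num)).prodMk
    (hasStrictFDerivAt_pi.mpr fun j => (P.contDiff_g j).contDiffAt.hasStrictFDerivAt (by norm_num))

theorem fderiv_G_apply (P : Problem n m J r) (x d : EuclideanSpace ℝ (Fin n)) :
    fderiv ℝ P.G x d = (fderiv ℝ P.h x d, fun j => fderiv ℝ (P.g j) x d) := by
  rw [(P.hasStrictFDerivAt_G x).hasFDerivAt.fderiv]
  rfl

theorem exists_add_isLineal (hx : x ∈ P.feasible) (hnd : P.IsNondegenerate x)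
    (w : ConstraintSpace m J r) : ∃ d v, P.IsLineal x v ∧ fderiv ℝ P.G x d + v = w := by
  have hw : w ∈ LinearMap.range (fderiv ℝ P.G x : EuclideanSpace ℝ (Fin n) →ₗ[ℝ] ConstraintSpace m J r)
      ⊔ linealitySpace (P.tangentK x) := by
    rw [hnd]; trivial
  obtain ⟨_, ⟨d, rfl⟩, v, hv, h⟩ := Submodule.mem_sup.mp hw
  exact ⟨d, v, isLineal_of_mem_linealitySpace hx hv, h⟩

/-- Under nondegeneracy, directions in the lineality space are tangent to curves that stay in the
faces of the constraint cones. -/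
theorem exists_feasible_curve (hx : x ∈ P.feasible) (hnd : P.IsNondegenerate x)
    {d : EuclideanSpace ℝ (Fin n)} (hd : P.IsLineal x (fderiv ℝ P.G x d)) :
    ∃ γ : ℝ → EuclideanSpace ℝ (Fin n), γ 0 = x ∧ HasDerivAt γ d 0 ∧
      ∀ᶠ t in 𝓝 0, P.h (γ t) = 0 ∧ ∀ j, P.g j (γ t) ∈ soc (r j) ∧
        (P.g j x = 0 → P.g j (γ t) = 0) ∧
        (‖tail (P.g j x)‖ = P.g j x 0 → ‖tail (P.g j (γ t))‖ = P.g j (γ t) 0) := by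
  choose φ φ' hφd hφ0 hφs hφe using fun j => exists_local_parametrization (hx.2 j)
  let Y := (j : Fin J) → EuclideanSpace ℝ (Fin (r j + 1))
  let μ : Y → ConstraintSpace m J r := fun v => (0, fun j => φ j (v j))
  let μ' : Y →L[ℝ] ConstraintSpace m J r :=
    (0 : Y →L[ℝ] EuclideanSpace ℝ (Fin m)).prod
      (ContinuousLinearMap.pi fun j => (φ' j).comp (ContinuousLinearMap.proj j))
  have hμ : HasStrictFDerivAt μ μ' 0 := by
    refine (hasStrictFDerivAt_const _ _).prodMk (hasStrictFDerivAt_pi.mpr fun j => ?_)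
    have hp : HasStrictFDerivAt (fun v : Y => v j) (ContinuousLinearMap.proj j) 0 :=
      (ContinuousLinearMap.proj (R := ℝ) (φ := fun j => EuclideanSpace ℝ (Fin (r j + 1)))
        j).hasStrictFDerivAt
    exact HasStrictFDerivAt.comp (0 : Y) (hφd j) hp
  have hG := P.hasStrictFDerivAt_G x
  rw [← hG.hasFDerivAt.fderiv] at hG
  -- Zeros of `Ψ` are points whose constraint values lie on the parametrized faces. Its derivative
  -- is onto by nondegeneracy, since `μ'` reproduces the lineality directions; for the same reason
  -- `d`, paired with its image, is in the kernel.
  let Ψ : EuclideanSpace ℝ (Fin n) × Y → ConstraintSpace m J r := fun p => P.G p.1 - μ p.2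
  let Ψ' : (EuclideanSpace ℝ (Fin n) × Y) →L[ℝ] ConstraintSpace m J r :=
    (fderiv ℝ P.G x).comp (ContinuousLinearMap.fst ℝ _ _) -
      μ'.comp (ContinuousLinearMap.snd ℝ _ _)
  have hΨ : HasStrictFDerivAt Ψ Ψ' (x, 0) :=
    (HasStrictFDerivAt.comp (x, (0 : Y)) hG hasStrictFDerivAt_fst).sub
      (HasStrictFDerivAt.comp (x, (0 : Y)) hμ hasStrictFDerivAt_snd)
  have hμl : ∀ v : ConstraintSpace m J r, P.IsLineal x v → μ' v.2 = v := by
    intro v hv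
    refine Prod.ext hv.1.symm (funext fun j => ?_)
    exact hφs j (v.2 j) (hv.2 j)
  have hΨa : ∀ p, Ψ' p = fderiv ℝ P.G x p.1 - μ' p.2 := fun p => rfl
  have hsurj : Ψ'.range = ⊤ := by
    refine LinearMap.range_eq_top.mpr fun w => ?_
    obtain ⟨e, v, hv, hw⟩ := exists_add_isLineal hx hnd w
    refine ⟨(e, -v.2), ?_⟩
    change Ψ' (e, -v.2) = w
    rw [hΨa, map_neg, hμl v hv, sub_neg_eq_add, hw]
  have hker : (d, (fderiv ℝ P.G x d).2) ∈ Ψ'.ker := by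
    change Ψ' (d, (fderiv ℝ P.G x d).2) = 0
    rw [hΨa, hμl _ hd, sub_self]
  let κ : Ψ'.ker := ⟨_, hker⟩
  let Γ : ℝ → EuclideanSpace ℝ (Fin n) × Y := fun t =>
    hΨ.implicitFunction Ψ Ψ' hsurj (Ψ (x, 0)) (t • κ)
  have hΨ0 : Ψ (x, 0) = 0 := by
    refine sub_eq_zero.mpr (Prod.ext hx.1 (funext fun j => ?_))
    exact (hφ0 j).symm
  have hΓ0 : Γ 0 = (x, 0) := by
    change hΨ.implicitFunction Ψ Ψ' hsurj (Ψ (x, 0)) ((0 : ℝ) • κ) = _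
    rw [zero_smul, HasStrictFDerivAt.implicitFunction_apply_image]
  have hline : HasDerivAt (fun t : ℝ => t • κ) κ 0 := by
    simpa using (hasDerivAt_id (0 : ℝ)).smul_const κ
  have hΓ : HasDerivAt Γ (d, (fderiv ℝ P.G x d).2) 0 := by
    have h1 := (hΨ.to_implicitFunction hsurj).hasFDerivAt
    have h2 : HasFDerivAt (hΨ.implicitFunction Ψ Ψ' hsurj (Ψ (x, 0))) Ψ'.ker.subtypeL
        ((0 : ℝ) • κ) := by rwa [zero_smul]
    exact h2.comp_hasDerivAt (0 : ℝ) hline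
  have hmap : ∀ᶠ t in 𝓝 (0 : ℝ), Ψ (Γ t) = 0 := by
    have h1 := hΨ.map_implicitFunction_eq hsurj
    have h2 : Tendsto (fun t : ℝ => (Ψ (x, 0), t • κ)) (𝓝 0) (𝓝 (Ψ (x, 0), 0)) := by
      refine tendsto_const_nhds.prodMk_nhds ?_
      have := hline.continuousAt.tendsto
      rwa [zero_smul] at this
    filter_upwards [h2.eventually h1] with t ht
    exact ht.trans hΨ0
  have hsnd : Tendsto (fun t => (Γ t).2) (𝓝 0) (𝓝 0) := by
    have := (continuous_snd.tendsto _).comp hΓ.continuousAt.tendsto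
    rwa [hΓ0] at this
  have hev : ∀ᶠ t in 𝓝 (0 : ℝ), ∀ j, φ j ((Γ t).2 j) ∈ soc (r j) ∧
      (P.g j x = 0 → φ j ((Γ t).2 j) = 0) ∧
      (‖tail (P.g j x)‖ = P.g j x 0 → ‖tail (φ j ((Γ t).2 j))‖ = φ j ((Γ t).2 j) 0) :=
    eventually_all.mpr fun j => ((tendsto_pi_nhds.mp hsnd) j).eventually (hφe j)
  refine ⟨fun t => (Γ t).1, congrArg Prod.fst hΓ0, ?_, ?_⟩
  · exact (hasFDerivAt_fst (p := Γ 0)).comp_hasDerivAt (0 : ℝ) hΓ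
  · filter_upwards [hmap, hev] with t h1 h2
    have h3 : P.G (Γ t).1 = μ (Γ t).2 := sub_eq_zero.mp h1
    have h4 : ∀ j, P.g j (Γ t).1 = φ j ((Γ t).2 j) := fun j =>
      congrFun (congrArg Prod.snd h3) j
    refine ⟨congrArg Prod.fst h3, fun j => ?_⟩
    rw [h4]
    exact h2 j

variable {lam : EuclideanSpace ℝ (Fin m)} {mu : (j : Fin J) → EuclideanSpace ℝ (Fin (r j + 1))}

theorem IsMultiplier.comp (h : P.IsMultiplier x lam mu) (j : Fin J) :
    P.g j x ∈ soc (r j) ∧ mu j ∈ soc (r j) ∧ inner ℝ (P.g j x) (mu j) = (0 : ℝ) := by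
  have := (isSelfDual_soc (r j)).mem_normalCone_iff.mp (h.2.2 j)
  rwa [neg_neg] at this

theorem IsMultiplier.feasible (h : P.IsMultiplier x lam mu) : x ∈ P.feasible :=
  ⟨h.2.1.1, fun j => (h.comp j).1⟩

theorem contDiff_lagrangian (P : Problem n m J r) (lam : EuclideanSpace ℝ (Fin m))
    (mu : (j : Fin J) → EuclideanSpace ℝ (Fin (r j + 1))) : ContDiff ℝ 2 (P.lagrangian lam mu) :=
  (P.contDiff_f.sub (contDiff_const.inner ℝ P.contDiff_h)).sub
    (ContDiff.sum fun j _ => contDiff_const.inner ℝ (P.contDiff_g j))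

theorem IsMultiplier.fderiv_f_apply (h : P.IsMultiplier x lam mu) (d : EuclideanSpace ℝ (Fin n)) :
    fderiv ℝ P.f x d = inner ℝ lam (fderiv ℝ P.h x d) +
      ∑ j, inner ℝ (mu j) (fderiv ℝ (P.g j) x d) := by
  have hf : HasFDerivAt P.f (fderiv ℝ P.f x) x :=
    (P.contDiff_f.differentiable (by norm_num) x).hasFDerivAt
  have hh : HasFDerivAt P.h (fderiv ℝ P.h x) x :=
    (P.contDiff_h.differentiable (by norm_num) x).hasFDerivAt
  have hg : ∀ j, HasFDerivAt (P.g j) (fderiv ℝ (P.g j) x) x := fun j =>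
    ((P.contDiff_g j).differentiable (by norm_num) x).hasFDerivAt
  have hL : HasFDerivAt (P.lagrangian lam mu)
      (fderiv ℝ P.f x - (innerSL ℝ lam).comp (fderiv ℝ P.h x) -
        ∑ j, (innerSL ℝ (mu j)).comp (fderiv ℝ (P.g j) x)) x :=
    (hf.sub ((innerSL ℝ lam).hasFDerivAt.comp x hh)).sub
      (HasFDerivAt.fun_sum fun j _ => (innerSL ℝ (mu j)).hasFDerivAt.comp x (hg j))
  have h0 := hL.fderiv
  rw [h.1] at h0
  have := congrArg (fun f : EuclideanSpace ℝ (Fin n) →L[ℝ] ℝ => f d) h0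
  simp at this
  linarith

theorem IsMultiplier.eq_smul_reflectE (h : P.IsMultiplier x lam mu) {j : Fin J}
    (hg : P.g j x ≠ 0) : mu j = (mu j 0 / P.g j x 0) • reflectE (P.g j x) :=
  tail_eq_of_comp (h.comp j).1 (h.comp j).2.1 (h.comp j).2.2
    (head_pos_of_ne_zero (h.comp j).1 hg)

/-- The quadratic form `w ↦ ẇ² - ‖w̄‖²`. -/
def lorentz {r : ℕ} (w : EuclideanSpace ℝ (Fin (r + 1))) : ℝ := w 0 ^ 2 - ‖tail w‖ ^ 2

/-- The Lorentz form vanishes at `g` and at `y`, so polarization leaves only the mixed term. This is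
where the curvature term of `Θ` comes from. -/
theorem inner_reflectE_of_boundary {r : ℕ} {g y : EuclideanSpace ℝ (Fin (r + 1))}
    (hg : ‖tail g‖ = g 0) (hy : ‖tail y‖ = y 0) :
    inner ℝ (reflectE g) y = -(1 / 2) * lorentz (y - g) := by
  rw [inner_reflectE, lorentz, tail_sub, norm_sub_sq_real, hg, hy, real_inner_comm,
    PiLp.sub_apply]
  ring

open Classical in
/-- The second-order necessary optimality condition on the lineality directions. -/
theorem second_order_necessary (hopt : P.IsLocallyOptimal x) (hmul : P.IsMultiplier x lam mu)
    (hnd : P.IsNondegenerate x) {d : EuclideanSpace ℝ (Fin n)}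
    (hd : P.IsLineal x (fderiv ℝ P.G x d)) :
    0 ≤ fderiv ℝ (fderiv ℝ (P.lagrangian lam mu)) x d d -
      ∑ j with j ∈ P.J3 x mu, mu j 0 / P.g j x 0 * lorentz (fderiv ℝ (P.g j) x d) := by
  have hx := hmul.feasible
  obtain ⟨γ, hγ0, hγ, hev⟩ := exists_feasible_curve hx hnd hd
  have hL := tendsto_second_difference (P.contDiff_lagrangian lam mu) hmul.1 hγ0 hγ
  have hγc : Tendsto γ (𝓝 0) (𝓝 x) := by
    have := hγ.continuousAt.tendsto
    rwa [hγ0] at this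
  have hq : ∀ j, Tendsto (fun t => lorentz (t⁻¹ • (P.g j (γ t) - P.g j x))) (𝓝[≠] 0)
      (𝓝 (lorentz (fderiv ℝ (P.g j) x d))) := by
    intro j
    have hg : HasDerivAt (fun t => P.g j (γ t)) (fderiv ℝ (P.g j) x d) 0 := by
      have h1 : HasFDerivAt (P.g j) (fderiv ℝ (P.g j) x) (γ 0) := by
        rw [hγ0]
        exact ((P.contDiff_g j).differentiable (by norm_num) x).hasFDerivAt
      exact h1.comp_hasDerivAt (0 : ℝ) hγ
    have hs := hasDerivAt_iff_tendsto_slope.mp hg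
    have hc : Continuous (lorentz : EuclideanSpace ℝ (Fin (r j + 1)) → ℝ) :=
      (continuous_head.pow 2).sub (continuous_tail.norm.pow 2)
    refine ((hc.tendsto _).comp hs).congr fun t => ?_
    rw [Function.comp_apply, slope_def_module, hγ0, sub_zero]
  have hlim := hL.sub (tendsto_finsetSum (Finset.univ.filter fun j => j ∈ P.J3 x mu)
    fun j _ => (hq j).const_mul (1 / 2 * (mu j 0 / P.g j x 0)))
  have hnonneg := ge_of_tendsto (b := 0) hlim ?_
  · have : (∑ j with j ∈ P.J3 x mu, 1 / 2 * (mu j 0 / P.g j x 0) * lorentz (fderiv ℝ (P.g j) x d))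
        = 1 / 2 * ∑ j with j ∈ P.J3 x mu,
          mu j 0 / P.g j x 0 * lorentz (fderiv ℝ (P.g j) x d) := by
      rw [Finset.mul_sum]
      exact Finset.sum_congr rfl fun j _ => by ring
    rw [this] at hnonneg
    linarith
  · have hmin : ∀ᶠ t in 𝓝 (0 : ℝ), P.G (γ t) ∈ coneK m J r → P.f x ≤ P.f (γ t) := by
      have := hopt.2
      rw [IsLocalMinOn, IsMinFilter, eventually_nhdsWithin_iff] at this
      filter_upwards [hγc.eventually this] with t ht hmem
      exact ht hmem
    filter_upwards [(hmin.and hev).filter_mono nhdsWithin_le_nhds, self_mem_nhdsWithin]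
      with t ⟨h1, h2, h3⟩ ht0
    have hf := h1 ⟨h2, fun j => (h3 j).1⟩
    -- Outside `J_3` either the constraint value stays `0` along the curve or the multiplier is `0`.
    -- In `J_3` the multiplier is a multiple of the reflected constraint value, and both constraint
    -- values are on the boundary.
    have hinn : ∀ j, (inner ℝ (mu j) (P.g j (γ t)) : ℝ) = if j ∈ P.J3 x mu then
        -(1 / 2) * (mu j 0 / P.g j x 0) * lorentz (P.g j (γ t) - P.g j x) else 0 := by
      intro j
      obtain ⟨c1, c2, c3⟩ := hmul.comp j
      split_ifs with hj
      · have hgb := mem_frontier_soc.mp hj.1.1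
        have hmu := hmul.eq_smul_reflectE (j := j) hj.1.2
        conv_lhs => rw [hmu]
        rw [real_inner_smul_left, inner_reflectE_of_boundary hgb ((h3 j).2.2 hgb)]
        ring
      · by_cases hg0 : P.g j x = 0
        · rw [(h3 j).2.1 hg0, inner_zero_right]
        · have hm0 : mu j = 0 := by
            by_contra hm0
            have hmp := head_pos_of_ne_zero c2 hm0
            have hgp := head_pos_of_ne_zero c1 hg0
            exact hj ⟨⟨mem_frontier_soc.mpr (norm_tail_eq_head c1 c2 c3 hmp), hg0⟩,
              ⟨mem_frontier_soc.mpr (norm_tail_eq_head c2 c1 (by rwa [real_inner_comm]) hgp), hm0⟩⟩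
          rw [hm0, inner_zero_left]
    have hLx : P.lagrangian lam mu x = P.f x := by
      have e1 : P.h x = 0 := hx.1
      have e2 : ∀ j, (inner ℝ (mu j) (P.g j x) : ℝ) = 0 := fun j => by
        rw [real_inner_comm]; exact (hmul.comp j).2.2
      simp [lagrangian, e1, e2]
    have hLt : P.lagrangian lam mu (γ t) = P.f (γ t) + ∑ j with j ∈ P.J3 x mu,
        1 / 2 * (mu j 0 / P.g j x 0) * lorentz (P.g j (γ t) - P.g j x) := by
      rw [lagrangian, h2, inner_zero_right, sub_zero, Finset.sum_congr rfl fun j _ => hinn j,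
        ← Finset.sum_filter, sub_eq_add_neg, ← Finset.sum_neg_distrib]
      congr 1
      exact Finset.sum_congr rfl fun j _ => by ring
    have hsc : ∀ j, lorentz (t⁻¹ • (P.g j (γ t) - P.g j x)) =
        t⁻¹ ^ 2 * lorentz (P.g j (γ t) - P.g j x) := by
      intro j
      rw [lorentz, lorentz, tail_smul, norm_smul, PiLp.smul_apply, smul_eq_mul, mul_pow, mul_pow,
        Real.norm_eq_abs, sq_abs]
      ring
    have hfin : t⁻¹ ^ 2 * (P.lagrangian lam mu (γ t) - P.lagrangian lam mu x) -
        ∑ j with j ∈ P.J3 x mu, 1 / 2 * (mu j 0 / P.g j x 0) *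
          lorentz (t⁻¹ • (P.g j (γ t) - P.g j x)) = t⁻¹ ^ 2 * (P.f (γ t) - P.f x) := by
      have : (∑ j with j ∈ P.J3 x mu, 1 / 2 * (mu j 0 / P.g j x 0) *
          lorentz (t⁻¹ • (P.g j (γ t) - P.g j x))) = t⁻¹ ^ 2 * ∑ j with j ∈ P.J3 x mu,
            1 / 2 * (mu j 0 / P.g j x 0) * lorentz (P.g j (γ t) - P.g j x) := by
        rw [Finset.mul_sum]
        exact Finset.sum_congr rfl fun j _ => by rw [hsc]; ring
      rw [this, hLt, hLx]
      ring
    rw [hfin]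
    have : 0 ≤ t⁻¹ ^ 2 := sq_nonneg _
    exact mul_nonneg this (by linarith)

end Problem

/-! ### Jacobian and Hessian matrices as maps -/

section Matrices

variable {n : ℕ}

theorem toLp_eq_sum_single (v : Fin n → ℝ) :
    WithLp.toLp 2 v = ∑ b, v b • EuclideanSpace.single b (1 : ℝ) := by
  ext i
  simp [Finset.sum_apply, Pi.single_apply]

theorem jacobian_mulVec {k : ℕ} (φ : EuclideanSpace ℝ (Fin n) → EuclideanSpace ℝ (Fin k))
    (x : EuclideanSpace ℝ (Fin n)) (v : Fin n → ℝ) :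
    WithLp.toLp 2 ((jacobian φ x).mulVec v) = fderiv ℝ φ x (WithLp.toLp 2 v) := by
  rw [toLp_eq_sum_single v, map_sum]
  ext i
  simp [Matrix.mulVec, dotProduct, jacobian, mul_comm]

theorem dotProduct_hessian_mulVec (φ : EuclideanSpace ℝ (Fin n) → ℝ)
    (x : EuclideanSpace ℝ (Fin n)) (u v : Fin n → ℝ) :
    u ⬝ᵥ (hessian φ x).mulVec v =
      fderiv ℝ (fderiv ℝ φ) x (WithLp.toLp 2 u) (WithLp.toLp 2 v) := by
  rw [toLp_eq_sum_single u, toLp_eq_sum_single v]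
  simp [Matrix.mulVec, dotProduct, hessian, Finset.mul_sum, mul_comm, mul_left_comm]
  exact Finset.sum_comm

theorem hessian_transpose {φ : EuclideanSpace ℝ (Fin n) → ℝ} (hφ : ContDiff ℝ 2 φ)
    (x : EuclideanSpace ℝ (Fin n)) : (hessian φ x).transpose = hessian φ x := by
  ext a b
  exact hφ.contDiffAt.isSymmSndFDerivAt (by simp) _ _

theorem dotProduct_reflMatrix_mulVec {r : ℕ} (w : Fin (r + 1) → ℝ) :
    w ⬝ᵥ (reflMatrix r).mulVec w = Problem.lorentz (WithLp.toLp 2 w) := by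
  rw [Problem.lorentz, ← real_inner_self_eq_norm_sq]
  simp only [reflMatrix, Matrix.mulVec_diagonal, dotProduct, Fin.sum_univ_succ, Fin.cons_zero,
    Fin.cons_succ, PiLp.inner_apply, tail]
  simp [sq, sub_eq_add_neg]

end Matrices

namespace Problem

variable {n m J : ℕ} {r : Fin J → ℕ} {P : Problem n m J r} {x : EuclideanSpace ℝ (Fin n)}
  {lam : EuclideanSpace ℝ (Fin m)} {mu : (j : Fin J) → EuclideanSpace ℝ (Fin (r j + 1))}

theorem Theta_transpose (P : Problem n m J r) (x : EuclideanSpace ℝ (Fin n))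
    (mu : (j : Fin J) → EuclideanSpace ℝ (Fin (r j + 1))) (lam : EuclideanSpace ℝ (Fin m)) :
    (P.Theta x mu lam).transpose = P.Theta x mu lam := by
  rw [Theta, Matrix.transpose_sub, hessian_transpose (P.contDiff_lagrangian lam mu),
    Matrix.transpose_sum]
  congr 1
  refine Finset.sum_congr rfl fun j _ => ?_
  rw [Matrix.transpose_smul, Matrix.transpose_mul, Matrix.transpose_mul, Matrix.transpose_transpose,
    reflMatrix, Matrix.diagonal_transpose, Matrix.mul_assoc]

open Classical in
theorem dotProduct_Theta_mulVec (P : Problem n m J r) (x : EuclideanSpace ℝ (Fin n))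
    (mu : (j : Fin J) → EuclideanSpace ℝ (Fin (r j + 1))) (lam : EuclideanSpace ℝ (Fin m))
    (v : Fin n → ℝ) :
    v ⬝ᵥ (P.Theta x mu lam).mulVec v =
      fderiv ℝ (fderiv ℝ (P.lagrangian lam mu)) x (WithLp.toLp 2 v) (WithLp.toLp 2 v) -
      ∑ j with j ∈ P.J3 x mu, mu j 0 / P.g j x 0 *
        lorentz (fderiv ℝ (P.g j) x (WithLp.toLp 2 v)) := by
  rw [Theta, Matrix.sub_mulVec, dotProduct_sub, dotProduct_hessian_mulVec, Matrix.sum_mulVec,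
    dotProduct_sum]
  congr 1
  refine Finset.sum_congr rfl fun j _ => ?_
  rw [Matrix.smul_mulVec, dotProduct_smul, smul_eq_mul, ← Matrix.mulVec_mulVec,
    ← Matrix.mulVec_mulVec, Matrix.dotProduct_mulVec, Matrix.vecMul_transpose,
    dotProduct_reflMatrix_mulVec, jacobian_mulVec]

/-! ### The critical cone -/

/-- Linear relations satisfied by the critical directions, hence by their span. -/
theorem of_mem_affCritical (hmul : P.IsMultiplier x lam mu) {d : EuclideanSpace ℝ (Fin n)}
    (hd : d ∈ P.affCritical x) : fderiv ℝ P.h x d = 0 ∧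
      ∀ j, inner ℝ (mu j) (fderiv ℝ (P.g j) x d) = (0 : ℝ) ∧
        (P.g j x = 0 → mu j 0 • tail (fderiv ℝ (P.g j) x d) +
          (fderiv ℝ (P.g j) x d) 0 • tail (mu j) = 0) := by
  refine Submodule.span_induction (p := fun d _ => fderiv ℝ P.h x d = 0 ∧
      ∀ j, inner ℝ (mu j) (fderiv ℝ (P.g j) x d) = (0 : ℝ) ∧
        (P.g j x = 0 → mu j 0 • tail (fderiv ℝ (P.g j) x d) +
          (fderiv ℝ (P.g j) x d) 0 • tail (mu j) = 0)) ?_ ?_ ?_ ?_ hd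
  · rintro d ⟨h1, h2⟩
    rw [mem_tangentK_iff hmul.feasible, fderiv_G_apply] at h1
    obtain ⟨h0, h1⟩ := h1
    have hnn : ∀ j, 0 ≤ (inner ℝ (mu j) (fderiv ℝ (P.g j) x d) : ℝ) := fun j =>
      h1 j (mu j) (hmul.comp j).2.1 (by rw [real_inner_comm]; exact (hmul.comp j).2.2)
    have h0' : fderiv ℝ P.h x d = 0 := h0
    rw [hmul.fderiv_f_apply, h0', inner_zero_right, zero_add] at h2
    -- By stationarity the derivative of `f` is a sum of nonnegative terms; as it is at most `0`,
    -- every term vanishes.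
    have hz := (Finset.sum_eq_zero_iff_of_nonneg fun j _ => hnn j).mp
      (le_antisymm h2 (Finset.sum_nonneg fun j _ => hnn j))
    refine ⟨h0, fun j => ⟨hz j (Finset.mem_univ j), fun hg => ?_⟩⟩
    refine head_smul_tail_add_eq_zero (hmul.comp j).2.1 ?_ (hz j (Finset.mem_univ j))
    exact (isSelfDual_soc (r j) _).mpr fun w hw => h1 j w hw (by rw [hg, inner_zero_right])
  · refine ⟨map_zero _, fun j => ?_⟩
    rw [map_zero]
    simp [tail_zero]
  · rintro a b - - ⟨ha, ha'⟩ ⟨hb, hb'⟩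
    refine ⟨by rw [map_add, ha, hb, add_zero], fun j => ⟨?_, fun hg => ?_⟩⟩
    · rw [map_add, inner_add_right, (ha' j).1, (hb' j).1, add_zero]
    · have h1 := (ha' j).2 hg
      have h2 := (hb' j).2 hg
      rw [map_add, tail_add, PiLp.add_apply]
      linear_combination (norm := module) h1 + h2
  · rintro c a - ⟨ha, ha'⟩
    refine ⟨by rw [map_smul, ha, smul_zero], fun j => ⟨?_, fun hg => ?_⟩⟩
    · rw [map_smul, real_inner_smul_right, (ha' j).1, mul_zero]
    · have h1 := (ha' j).2 hg
      rw [map_smul, tail_smul, PiLp.smul_apply, smul_eq_mul]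
      linear_combination (norm := module) c • h1

open Classical in
/-- The vector defining the row `𝒢_j` for `j ∈ J_4 ∪ J_5`. -/
def rowVec (P : Problem n m J r) (x : EuclideanSpace ℝ (Fin n))
    (mu : (j : Fin J) → EuclideanSpace ℝ (Fin (r j + 1))) (j : Fin J) :
    EuclideanSpace ℝ (Fin (r j + 1)) :=
  if j ∈ P.J4 x mu then reflectE (mu j) else reflectE (P.g j x)

theorem disjoint_J45_J6 {j : Fin J} (h : j ∈ P.J4 x mu ∪ P.J5 x mu) : j ∉ P.J6 x mu := by
  rintro ⟨h1, h2⟩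
  rcases h with h | h
  · exact h.2.2 h2
  · exact h.1.2 h1

theorem not_mem_J4_of_mem_J5 {j : Fin J} (h : j ∈ P.J5 x mu) : j ∉ P.J4 x mu := fun h4 =>
  h.1.2 h4.1

/-- The span of the critical cone already supplies the relations for the other blocks. If `g = 0`
and `μ` is interior, orthogonality to `μ` and the Jordan relation force the image to be `0`; if `g`
and `μ` are both nonzero, `μ` is a positive multiple of the reflection of `g`. The rows and blocks
of `J_4`, `J_5`, `J_6` supply exactly what is missing. -/
theorem isLineal_of_rows_eq_zero (hmul : P.IsMultiplier x lam mu) {d : EuclideanSpace ℝ (Fin n)}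
    (hd : d ∈ P.affCritical x)
    (h45 : ∀ j ∈ P.J4 x mu ∪ P.J5 x mu,
      inner ℝ (P.rowVec x mu j) (fderiv ℝ (P.g j) x d) = (0 : ℝ))
    (h6 : ∀ j ∈ P.J6 x mu, fderiv ℝ (P.g j) x d = 0) :
    P.IsLineal x (fderiv ℝ P.G x d) := by
  obtain ⟨h0, hj⟩ := of_mem_affCritical hmul hd
  rw [fderiv_G_apply]
  refine ⟨h0, fun j w hw hwg => ?_⟩
  change inner ℝ w (fderiv ℝ (P.g j) x d) = (0 : ℝ)
  obtain ⟨c1, c2, c3⟩ := hmul.comp j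
  obtain ⟨h1, h2⟩ := hj j
  set y := fderiv ℝ (P.g j) x d
  by_cases hg : P.g j x = 0
  · suffices y = 0 by rw [this, inner_zero_right]
    by_cases hm : mu j = 0
    · exact h6 j ⟨hg, hm⟩
    have hmp := head_pos_of_ne_zero c2 hm
    have h3 := h2 hg
    suffices hy0 : y 0 = 0 by
      refine ext_head_tail hy0 ?_
      rw [hy0, zero_smul, add_zero] at h3
      rw [tail_zero]
      exact (smul_eq_zero.mp h3).resolve_left hmp.ne'
    rw [inner_eq_head_tail] at h1
    rcases (mem_soc.mp c2).lt_or_eq with hlt | heq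
    · have h4 := congrArg (fun v => inner ℝ (tail (mu j)) v) h3
      simp only [inner_add_right, real_inner_smul_right, real_inner_self_eq_norm_sq,
        inner_zero_right] at h4
      have h5 : (mu j 0 ^ 2 - ‖tail (mu j)‖ ^ 2) * y 0 = 0 := by
        linear_combination mu j 0 * h1 - h4
      refine (mul_eq_zero.mp h5).resolve_left ?_
      have := pow_lt_pow_left₀ hlt (norm_nonneg _) (n := 2) (by norm_num)
      linarith
    · have hj4 : j ∈ P.J4 x mu := ⟨hg, mem_frontier_soc.mpr heq, hm⟩
      have h4 := h45 j (Or.inl hj4)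
      rw [rowVec, if_pos hj4, inner_reflectE] at h4
      have h5 : mu j 0 * y 0 = 0 := by linarith
      exact (mul_eq_zero.mp h5).resolve_left hmp.ne'
  rcases (mem_soc.mp c1).lt_or_eq with hlt | heq
  · rw [eq_zero_of_inner_eq_zero hw hlt hwg, inner_zero_left]
  · have hgp := head_pos_of_ne_zero c1 hg
    have hrow : inner ℝ (reflectE (P.g j x)) y = (0 : ℝ) := by
      by_cases hm : mu j = 0
      · have hj5 : j ∈ P.J5 x mu := ⟨⟨mem_frontier_soc.mpr heq, hg⟩, hm⟩
        have := h45 j (Or.inr hj5)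
        rwa [rowVec, if_neg (not_mem_J4_of_mem_J5 hj5)] at this
      · have hmp := head_pos_of_ne_zero c2 hm
        rw [hmul.eq_smul_reflectE hg, real_inner_smul_left] at h1
        exact (mul_eq_zero.mp h1).resolve_left (div_pos hmp hgp).ne'
    have hw' : w = (w 0 / P.g j x 0) • reflectE (P.g j x) :=
      tail_eq_of_comp c1 hw (by rw [real_inner_comm]; exact hwg) hgp
    rw [hw', real_inner_smul_left, hrow, mul_zero]

/-- A target `t` is built in the cones, orthogonal to `μ`, and reached by nondegeneracy up to a
lineality vector. Such a vector changes neither tangency, nor the product with `μ`, nor the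
prescribed rows and blocks. -/
theorem exists_mem_criticalCone (hmul : P.IsMultiplier x lam mu) (hnd : P.IsNondegenerate x)
    (b : Fin J → ℝ) (hb : ∀ j, 0 ≤ b j) (w : (j : Fin J) → EuclideanSpace ℝ (Fin (r j + 1)))
    (hw : ∀ j, w j ∈ soc (r j)) :
    ∃ d ∈ P.criticalCone x,
      (∀ j ∈ P.J4 x mu ∪ P.J5 x mu,
        inner ℝ (P.rowVec x mu j) (fderiv ℝ (P.g j) x d) = b j) ∧
      ∀ j ∈ P.J6 x mu, fderiv ℝ (P.g j) x d = w j := by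
  classical
  -- The scalings come from `‖reflectE μ‖² = 2 μ̇²` for boundary `μ`, and from the product `ġ` of
  -- `reflectE g` with the axis vector.
  let t : (j : Fin J) → EuclideanSpace ℝ (Fin (r j + 1)) := fun j =>
    if j ∈ P.J4 x mu then (b j / (2 * mu j 0 ^ 2)) • reflectE (mu j)
    else if j ∈ P.J5 x mu then (b j / P.g j x 0) • ofHeadTail 1 0
    else if j ∈ P.J6 x mu then w j else 0
  have ht4 : ∀ j ∈ P.J4 x mu, t j = (b j / (2 * mu j 0 ^ 2)) • reflectE (mu j) := fun j hj => by
    simp only [t, if_pos hj]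
  have ht5 : ∀ j ∈ P.J5 x mu, t j = (b j / P.g j x 0) • ofHeadTail 1 0 := fun j hj => by
    simp only [t, if_neg (not_mem_J4_of_mem_J5 hj), if_pos hj]
  have ht6 : ∀ j ∈ P.J6 x mu, t j = w j := fun j hj => by
    have h4 : j ∉ P.J4 x mu := fun h => disjoint_J45_J6 (Or.inl h) hj
    have h5 : j ∉ P.J5 x mu := fun h => disjoint_J45_J6 (Or.inr h) hj
    simp only [t, if_neg h4, if_neg h5, if_pos hj]
  have htK : ∀ j, t j ∈ soc (r j) := by
    intro j
    simp only [t]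
    split_ifs with h4 h5 h6
    · exact (isSelfDual_soc _).smul_mem (reflectE_mem_soc (hmul.comp j).2.1)
        (div_nonneg (hb j) (by positivity))
    · exact (isSelfDual_soc _).smul_mem axis_mem_soc
        (div_nonneg (hb j) (head_nonneg (hmul.comp j).1))
    · exact hw j
    · exact (isSelfDual_soc _).zero_mem
  have htmu : ∀ j, inner ℝ (mu j) (t j) = (0 : ℝ) := by
    intro j
    simp only [t]
    split_ifs with h4 h5 h6
    · rw [real_inner_smul_right, real_inner_comm,
        inner_reflectE_self (mem_frontier_soc.mp h4.2.1), mul_zero]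
    · rw [h5.2, inner_zero_left]
    · rw [h6.2, inner_zero_left]
    · exact inner_zero_right _
  obtain ⟨d, v, hv, hdv⟩ := exists_add_isLineal hmul.feasible hnd (0, t)
  rw [fderiv_G_apply] at hdv
  have hd1 : fderiv ℝ P.h x d = 0 := by
    have h1 : fderiv ℝ P.h x d + v.1 = 0 := congrArg Prod.fst hdv
    rwa [hv.1, add_zero] at h1
  have hd2 : ∀ j, fderiv ℝ (P.g j) x d = t j - v.2 j := fun j =>
    eq_sub_of_add_eq (congrFun (congrArg Prod.snd hdv) j)
  have hv0 : ∀ j, P.g j x = 0 → v.2 j = 0 := by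
    intro j hg
    have h1 : ∀ m ∈ soc (r j), inner ℝ m (v.2 j) = (0 : ℝ) := fun m hm =>
      hv.2 j m hm (by rw [hg, inner_zero_right])
    exact inner_self_eq_zero.mp (h1 _ ((isSelfDual_soc _ _).mpr fun m hm => (h1 m hm).ge))
  refine ⟨d, ⟨?_, ?_⟩, ?_, ?_⟩
  · rw [mem_tangentK_iff hmul.feasible, fderiv_G_apply]
    refine ⟨hd1, fun j m hm hmg => ?_⟩
    change 0 ≤ (inner ℝ m (fderiv ℝ (P.g j) x d) : ℝ)
    rw [hd2, inner_sub_right, hv.2 j m hm hmg, sub_zero]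
    exact (isSelfDual_soc _).inner_nonneg hm (htK j)
  · rw [hmul.fderiv_f_apply, hd1, inner_zero_right, zero_add]
    refine (Finset.sum_eq_zero fun j _ => ?_).le
    rw [hd2, inner_sub_right, htmu, hv.2 j _ (hmul.comp j).2.1
      (by rw [real_inner_comm]; exact (hmul.comp j).2.2), sub_zero]
  · rintro j (h4 | h5)
    · rw [hd2, hv0 j h4.1, sub_zero, ht4 j h4, rowVec, if_pos h4, real_inner_smul_right]
      have hmp := head_pos_of_ne_zero (hmul.comp j).2.1 h4.2.2
      have h1 : inner ℝ (reflectE (mu j)) (reflectE (mu j)) = 2 * mu j 0 ^ 2 := by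
        have := mem_frontier_soc.mp h4.2.1
        rw [inner_reflectE, reflectE, tail_ofHeadTail, ofHeadTail_zero, inner_neg_right,
          real_inner_self_eq_norm_sq, this]
        ring
      rw [h1]
      field_simp
    · have hgb := mem_frontier_soc.mp h5.1.1
      have hgp := head_pos_of_ne_zero (hmul.comp j).1 h5.1.2
      rw [hd2, rowVec, if_neg (not_mem_J4_of_mem_J5 h5), inner_sub_right,
        hv.2 j _ (reflectE_mem_soc (hmul.comp j).1) (inner_reflectE_self hgb), ht5 j h5,
        real_inner_smul_right, inner_reflectE]
      simp only [ofHeadTail_zero, tail_ofHeadTail, inner_zero_right]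
      field_simp
      ring
  · intro j h6
    rw [hd2, hv0 j h6.1, sub_zero, ht6 j h6]

/-- The rows `𝒢_j` are jointly surjective on the span of the critical cone. -/
theorem exists_mem_affCritical (hmul : P.IsMultiplier x lam mu) (hnd : P.IsNondegenerate x)
    (b : Fin J → ℝ) (w : (j : Fin J) → EuclideanSpace ℝ (Fin (r j + 1))) :
    ∃ d ∈ P.affCritical x,
      (∀ j ∈ P.J4 x mu ∪ P.J5 x mu,
        inner ℝ (P.rowVec x mu j) (fderiv ℝ (P.g j) x d) = b j) ∧
      ∀ j ∈ P.J6 x mu, fderiv ℝ (P.g j) x d = w j := by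
  have hax : ∀ j, (2 * ‖w j‖) • ofHeadTail 1 0 ∈ soc (r j) := fun j =>
    (isSelfDual_soc _).smul_mem axis_mem_soc (by positivity)
  -- Arbitrary data is a difference of admissible data: `b = (b + |b|) - |b|`, and `2 ‖w‖` times the
  -- axis moves `w` into the cone.
  obtain ⟨d1, hd1, h1, h1'⟩ := exists_mem_criticalCone hmul hnd (fun j => b j + |b j|)
    (fun j => by linarith [neg_abs_le (b j)]) (fun j => w j + (2 * ‖w j‖) • ofHeadTail 1 0)
    (fun j => by
      rw [mem_soc, tail_add, tail_smul, tail_ofHeadTail, smul_zero, add_zero]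
      have e1 := norm_tail_le_norm (w j)
      have e2 := (abs_le.mp (abs_head_le_norm (w j))).1
      simp only [PiLp.add_apply, PiLp.smul_apply, ofHeadTail_zero, smul_eq_mul, mul_one]
      linarith)
  obtain ⟨d2, hd2, h2, h2'⟩ := exists_mem_criticalCone hmul hnd (fun j => |b j|)
    (fun j => abs_nonneg _) (fun j => (2 * ‖w j‖) • ofHeadTail 1 0) hax
  refine ⟨d1 - d2, Submodule.sub_mem _ (Submodule.subset_span hd1) (Submodule.subset_span hd2),
    fun j hj => ?_, fun j hj => ?_⟩
  · rw [map_sub, inner_sub_right, h1 j hj, h2 j hj]; ring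
  · rw [map_sub, h1' j hj, h2' j hj]; abel


variable {n m J : ℕ} {r : Fin J → ℕ} {P : Problem n m J r} {x : EuclideanSpace ℝ (Fin n)}
  {lam : EuclideanSpace ℝ (Fin m)} {mu : (j : Fin J) → EuclideanSpace ℝ (Fin (r j + 1))}
  {l : ℕ} {H : Matrix (Fin n) (Fin l) ℝ}

/-! ### Positive definiteness of the reduced Hessian -/

theorem inner_reflectE_eq_dotProduct {k : ℕ} (y : EuclideanSpace ℝ (Fin (k + 1)))
    (w : Fin (k + 1) → ℝ) : inner ℝ (reflectE y) (WithLp.toLp 2 w) = reflect y ⬝ᵥ w := by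
  rw [inner_reflectE]
  simp only [reflect, dotProduct, Fin.sum_univ_succ, Fin.cons_zero, Fin.cons_succ,
    PiLp.inner_apply, tail]
  simp [mul_comm, sub_eq_add_neg]

theorem toLp_calGMat_mulVec (j : Fin J) (ν : Fin l → ℝ) :
    WithLp.toLp 2 ((P.calGMat x H j).mulVec ν) =
      fderiv ℝ (P.g j) x (WithLp.toLp 2 (H.mulVec ν)) := by
  rw [calGMat, ← Matrix.mulVec_mulVec, jacobian_mulVec]

theorem calGRow_dotProduct (j : Fin J) (ν : Fin l → ℝ) :
    P.calGRow x mu H j ⬝ᵥ ν =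
      inner ℝ (P.rowVec x mu j) (fderiv ℝ (P.g j) x (WithLp.toLp 2 (H.mulVec ν))) := by
  rw [← toLp_calGMat_mulVec, calGRow, rowVec]
  split_ifs <;> rw [inner_reflectE_eq_dotProduct, ← Matrix.dotProduct_mulVec, calGMat]

theorem mulVec_mem_affCritical
    (hrange : LinearMap.range (Matrix.toEuclideanLin H) = P.affCritical x) (ν : Fin l → ℝ) :
    WithLp.toLp 2 (H.mulVec ν) ∈ P.affCritical x := by
  rw [← hrange]
  exact ⟨WithLp.toLp 2 ν, by simp⟩

theorem exists_mulVec_eq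
    (hrange : LinearMap.range (Matrix.toEuclideanLin H) = P.affCritical x)
    {d : EuclideanSpace ℝ (Fin n)} (hd : d ∈ P.affCritical x) :
    ∃ ν : Fin l → ℝ, WithLp.toLp 2 (H.mulVec ν) = d := by
  rw [← hrange] at hd
  obtain ⟨ν, rfl⟩ := hd
  exact ⟨ν.ofLp, by simp [Matrix.toLpLin_apply]⟩

/-- `ν ↦ 𝒢_j ν` for `j ∈ J_4 ∪ J_5`. -/
def rowMap (P : Problem n m J r) (x : EuclideanSpace ℝ (Fin n))
    (mu : (j : Fin J) → EuclideanSpace ℝ (Fin (r j + 1))) (H : Matrix (Fin n) (Fin l) ℝ)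
    (j : Fin J) : (Fin l → ℝ) →ₗ[ℝ] ℝ where
  toFun ν := P.calGRow x mu H j ⬝ᵥ ν
  map_add' := dotProduct_add _
  map_smul' c ν := dotProduct_smul c _ ν

/-- `ν ↦ 𝒢_j ν` for `j ∈ J_6`. -/
def blockMap (P : Problem n m J r) (x : EuclideanSpace ℝ (Fin n)) (H : Matrix (Fin n) (Fin l) ℝ)
    (j : Fin J) : (Fin l → ℝ) →ₗ[ℝ] EuclideanSpace ℝ (Fin (r j + 1)) :=
  (WithLp.linearEquiv 2 ℝ (Fin (r j + 1) → ℝ)).symm.toLinearMap ∘ₗ (P.calGMat x H j).mulVecLin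

theorem rowMap_apply (j : Fin J) (ν : Fin l → ℝ) :
    P.rowMap x mu H j ν = P.calGRow x mu H j ⬝ᵥ ν := rfl

theorem blockMap_apply (j : Fin J) (ν : Fin l → ℝ) :
    P.blockMap x H j ν = WithLp.toLp 2 ((P.calGMat x H j).mulVec ν) := rfl

open Classical in
/-- The kernel of `𝒢_j`, and the whole space if `j ∉ J_4 ∪ J_5 ∪ J_6`. -/
def blockKer (P : Problem n m J r) (x : EuclideanSpace ℝ (Fin n))
    (mu : (j : Fin J) → EuclideanSpace ℝ (Fin (r j + 1))) (H : Matrix (Fin n) (Fin l) ℝ)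
    (j : Fin J) : Submodule ℝ (Fin l → ℝ) :=
  if j ∈ P.J4 x mu ∪ P.J5 x mu then LinearMap.ker (P.rowMap x mu H j)
  else if j ∈ P.J6 x mu then LinearMap.ker (P.blockMap x H j) else ⊤

open Classical in
/-- The functionals `𝒢_jᵀ p^j` of the reduced coderivative condition. -/
def blockRel (P : Problem n m J r) (x : EuclideanSpace ℝ (Fin n))
    (mu : (j : Fin J) → EuclideanSpace ℝ (Fin (r j + 1))) (H : Matrix (Fin n) (Fin l) ℝ)
    (j : Fin J) : (Fin l → ℝ) → ((Fin l → ℝ) →ₗ[ℝ] ℝ) → Prop :=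
  if j ∈ P.J4 x mu ∪ P.J5 x mu then CoderivRel (Set.Ici (0 : ℝ)) (P.rowMap x mu H j)
  else if j ∈ P.J6 x mu then CoderivRel (soc (r j)) (P.blockMap x H j) else fun _ φ => φ = 0

theorem coderivRel_of_ker {V E : Type*} [AddCommGroup V] [Module ℝ V] [NormedAddCommGroup E]
    [InnerProductSpace ℝ E] [FiniteDimensional ℝ E] {K : Set E} (hK : IsSelfDual K) {e : E}
    (heK : e ∈ K) {c : ℝ} (hc : 0 < c) (he : ∀ y ∈ K, c * ‖y‖ ≤ inner ℝ e y) (A : V →ₗ[ℝ] E)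
    {ν : V} (hν : ν ∈ LinearMap.ker A) {φ : V →ₗ[ℝ] ℝ} (hφ : ∀ v ∈ LinearMap.ker A, φ v = 0) :
    CoderivRel K A ν φ := by
  obtain ⟨p, hp⟩ := exists_inner_eq_of_ker φ A ⊤ fun v _ hv => hφ v hv
  refine ⟨p, ?_, fun v => hp v trivial⟩
  rw [LinearMap.mem_ker.mp hν]
  exact mem_coderivative_zero hK heK hc he p

theorem coderivRel_zero {V E : Type*} [AddCommGroup V] [Module ℝ V] [NormedAddCommGroup E]
    [InnerProductSpace ℝ E] {K : Set E} (hK : IsSelfDual K) {e : E}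
    (heK : e ∈ K) {c : ℝ} (hc : 0 < c) (he : ∀ y ∈ K, c * ‖y‖ ≤ inner ℝ e y) (A : V →ₗ[ℝ] E)
    (ν : V) : CoderivRel K A ν 0 :=
  ⟨0, zero_mem_coderivative hK heK hc he _, fun v => by simp⟩

theorem reducedHessian_transpose (P : Problem n m J r) (x : EuclideanSpace ℝ (Fin n))
    (mu : (j : Fin J) → EuclideanSpace ℝ (Fin (r j + 1))) (lam : EuclideanSpace ℝ (Fin m))
    (H : Matrix (Fin n) (Fin l) ℝ) :
    (H.transpose * P.Theta x mu lam * H).transpose = H.transpose * P.Theta x mu lam * H := by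
  rw [Matrix.transpose_mul, Matrix.transpose_mul, Matrix.transpose_transpose, Theta_transpose,
    Matrix.mul_assoc]

/-- The climbing argument applied to all blocks: optimality supplies nonnegativity on the common
kernel, and the coderivative condition excludes nontrivial solutions of the system. -/
theorem posDef_reducedHessian (hopt : P.IsLocallyOptimal x) (hmul : P.IsMultiplier x lam mu)
    (hnd : P.IsNondegenerate x)
    (hrange : LinearMap.range (Matrix.toEuclideanLin H) = P.affCritical x)
    (hcod : P.ReducedCoderivativeCondition x mu H lam) :
    (H.transpose * P.Theta x mu lam * H).PosDef := by
  classical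
  set A := H.transpose * P.Theta x mu lam * H with hA
  have hAt : A.transpose = A := P.reducedHessian_transpose x mu lam H
  let M : (Fin l → ℝ) →ₗ[ℝ] (Fin l → ℝ) →ₗ[ℝ] ℝ := Matrix.toLinearMap₂' ℝ A
  have hMa : ∀ u v, M u v = u ⬝ᵥ A.mulVec v := fun u v => Matrix.toLinearMap₂'_apply' A u v
  have hM : ∀ u v, M u v = M v u := by
    intro u v
    rw [hMa, hMa, Matrix.dotProduct_mulVec, ← Matrix.mulVec_transpose, hAt, dotProduct_comm]
  have hpos : PosOn M ⊤ := by
    refine posOn_top_of_climbs hM (N := P.blockKer x mu H) (Rel := P.blockRel x mu H)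
      ?_ ?_ ?_ ?_ ?_
    · intro j ν
      unfold blockRel
      split_ifs
      · exact coderivRel_zero isSelfDual_Ici (by simp) one_pos norm_le_inner_one_of_mem_Ici _ ν
      · exact coderivRel_zero (isSelfDual_soc _) axis_mem_soc one_half_pos norm_le_inner_axis _ ν
      · rfl
    · intro j ν hν φ hφ
      unfold blockRel
      unfold blockKer at hν hφ
      split_ifs at hν hφ ⊢
      · exact coderivRel_of_ker isSelfDual_Ici (by simp) one_pos norm_le_inner_one_of_mem_Ici _
          hν hφ
      · exact coderivRel_of_ker (isSelfDual_soc _) axis_mem_soc one_half_pos norm_le_inner_axis _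
          hν hφ
      · exact LinearMap.ext fun v => hφ v trivial
    · intro j
      unfold blockRel blockKer
      split_ifs
      · exact climbs_Ici hM _
      · exact climbs_soc _ hM _
      · intro U hU _
        rwa [inf_top_eq] at hU
    · intro ν hν
      rw [Submodule.mem_iInf] at hν
      have hlin : P.IsLineal x (fderiv ℝ P.G x (WithLp.toLp 2 (H.mulVec ν))) := by
        refine isLineal_of_rows_eq_zero hmul (mulVec_mem_affCritical hrange ν) ?_ ?_
        · intro j hj
          have := hν j
          rw [blockKer, if_pos hj, LinearMap.mem_ker, rowMap_apply, calGRow_dotProduct] at this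
          exact this
        · intro j hj
          have := hν j
          rw [blockKer, if_neg (fun h => disjoint_J45_J6 h hj), if_pos hj, LinearMap.mem_ker,
            blockMap_apply, toLp_calGMat_mulVec] at this
          exact this
      have h1 := second_order_necessary hopt hmul hnd hlin
      rw [← dotProduct_Theta_mulVec] at h1
      rw [hMa, hA, ← Matrix.mulVec_mulVec, ← Matrix.mulVec_mulVec, Matrix.dotProduct_mulVec,
        Matrix.vecMul_transpose]
      exact h1
    · intro ν φ hφ hsum
      by_contra hne
      have hp : ∀ j, ∃ p : ℝ, j ∈ P.J4 x mu ∪ P.J5 x mu →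
          p ∈ coderivative (normalCone (Set.Ici (0 : ℝ))) 0 0 (P.calGRow x mu H j ⬝ᵥ ν) ∧
            ∀ v, φ j v = p * (P.calGRow x mu H j ⬝ᵥ v) := by
        intro j
        by_cases hj : j ∈ P.J4 x mu ∪ P.J5 x mu
        · have := hφ j
          rw [blockRel, if_pos hj] at this
          obtain ⟨p, h1, h2⟩ := this
          exact ⟨p, fun _ => ⟨h1, fun v => by rw [h2, rowMap_apply]; simp [mul_comm]⟩⟩
        · exact ⟨0, fun h => absurd h hj⟩
      have hq : ∀ j, ∃ q : EuclideanSpace ℝ (Fin (r j + 1)), j ∈ P.J6 x mu →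
          q ∈ coderivative (normalCone (soc (r j))) 0 0
            (WithLp.toLp 2 ((P.calGMat x H j).mulVec ν)) ∧
            ∀ v, φ j v = inner ℝ q (WithLp.toLp 2 ((P.calGMat x H j).mulVec v)) := by
        intro j
        by_cases hj : j ∈ P.J6 x mu
        · have := hφ j
          rw [blockRel, if_neg (fun h => disjoint_J45_J6 h hj), if_pos hj] at this
          obtain ⟨q, h1, h2⟩ := this
          exact ⟨q, fun _ => ⟨h1, h2⟩⟩
        · exact ⟨0, fun h => absurd h hj⟩
      choose p hp using hp
      choose q hq using hq
      refine hcod ν hne p q (fun j hj => (hp j hj).1) (fun j hj => (hq j hj).1) ?_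
      refine dotProduct_eq _ _ fun v => ?_
      have h1 := LinearMap.congr_fun hsum v
      rw [LinearMap.add_apply, hM, hMa, LinearMap.sum_apply, LinearMap.zero_apply] at h1
      have h2 : ∀ j, φ j v = (if j ∈ P.J4 x mu ∪ P.J5 x mu then
          p j * (P.calGRow x mu H j ⬝ᵥ v) else 0) + (if j ∈ P.J6 x mu then
          (P.calGMat x H j).transpose.mulVec (q j) ⬝ᵥ v else 0) := by
        intro j
        by_cases h45 : j ∈ P.J4 x mu ∪ P.J5 x mu
        · rw [if_pos h45, if_neg (disjoint_J45_J6 h45), (hp j h45).2, add_zero]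
        · rw [if_neg h45, zero_add]
          split_ifs with h6
          · rw [(hq j h6).2, Matrix.mulVec_transpose, ← Matrix.dotProduct_mulVec,
              EuclideanSpace.inner_eq_star_dotProduct, star_trivial, dotProduct_comm]
          · have := hφ j
            rw [blockRel, if_neg h45, if_neg h6] at this
            rw [this, LinearMap.zero_apply]
      rw [Finset.sum_congr rfl fun j _ => h2 j, Finset.sum_add_distrib, ← Finset.sum_filter,
        ← Finset.sum_filter] at h1
      rw [neg_dotProduct, add_dotProduct, sum_dotProduct, sum_dotProduct, dotProduct_comm]
      simp only [smul_dotProduct, smul_eq_mul]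
      linarith
  refine Matrix.PosDef.of_dotProduct_mulVec_pos ?_ fun v hv => ?_
  · rw [Matrix.IsHermitian, Matrix.conjTranspose_eq_transpose_of_trivial, hAt]
  · rw [star_trivial, ← hMa]
    exact hpos v trivial hv

/-! ### The nested reductions -/

theorem calG_mulVec_of_mem_J6 {j : Fin J} (hj : j ∈ P.J6 x mu) (ν : Fin l → ℝ)
    (k : Fin (P.numRows x mu j)) :
    (P.calG x mu H j).mulVec ν k =
      (fderiv ℝ (P.g j) x (WithLp.toLp 2 (H.mulVec ν))) (Fin.castLE (P.numRows_le x mu j) k) := by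
  rw [← toLp_calGMat_mulVec]
  simp [calG, Matrix.mulVec, hj]

theorem calG_mulVec_of_mem_J45 {j : Fin J} (hj : j ∈ P.J4 x mu ∪ P.J5 x mu) (ν : Fin l → ℝ)
    (k : Fin (P.numRows x mu j)) :
    (P.calG x mu H j).mulVec ν k =
      inner ℝ (P.rowVec x mu j) (fderiv ℝ (P.g j) x (WithLp.toLp 2 (H.mulVec ν))) := by
  rw [← calGRow_dotProduct]
  simp [calG, Matrix.mulVec, disjoint_J45_J6 hj]

/-- The matrices `𝒢_j` are jointly surjective. -/
theorem exists_calG_mulVec_eq (hmul : P.IsMultiplier x lam mu) (hnd : P.IsNondegenerate x)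
    (hrange : LinearMap.range (Matrix.toEuclideanLin H) = P.affCritical x) {j₀ : Fin J}
    (hj₀ : j₀ ∈ P.J4 x mu ∪ P.J5 x mu ∪ P.J6 x mu) (c : Fin (P.numRows x mu j₀) → ℝ) :
    ∃ ν : Fin l → ℝ, (P.calG x mu H j₀).mulVec ν = c ∧
      ∀ j ∈ P.J4 x mu ∪ P.J5 x mu ∪ P.J6 x mu, j ≠ j₀ → (P.calG x mu H j).mulVec ν = 0 := by
  classical
  let b : Fin J → ℝ := fun j => if j = j₀ then
    (if h : 0 < P.numRows x mu j₀ then c ⟨0, h⟩ else 0) else 0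
  let w : (j : Fin J) → EuclideanSpace ℝ (Fin (r j + 1)) := fun j => if j = j₀ then
    WithLp.toLp 2 (fun k => if h : (k : ℕ) < P.numRows x mu j₀ then c ⟨k, h⟩ else 0) else 0
  obtain ⟨d, hd, h45, h6⟩ := exists_mem_affCritical hmul hnd b w
  obtain ⟨ν, rfl⟩ := exists_mulVec_eq hrange hd
  refine ⟨ν, ?_, fun j hj hne => ?_⟩
  · ext k
    rcases hj₀ with h | h
    · rw [calG_mulVec_of_mem_J45 h, h45 _ h]
      have h1 : P.numRows x mu j₀ = 1 := by
        rw [numRows, if_neg (disjoint_J45_J6 h)]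
      have hk : k = ⟨0, by omega⟩ := Fin.ext (by have := k.2; omega)
      have h2 : 0 < P.numRows x mu j₀ := by omega
      simp only [b, if_true, dif_pos h2, hk]
    · rw [calG_mulVec_of_mem_J6 h, h6 _ h]
      simp [w]
  · ext k
    rcases hj with h | h
    · rw [calG_mulVec_of_mem_J45 h, h45 _ h]
      simp [b, hne]
    · rw [calG_mulVec_of_mem_J6 h, h6 _ h]
      simp [w, hne]

/-- By rank-nullity the kernel of `B` has dimension `a - c`, the number of columns of `R`.
Surjectivity of `B` also ensures `c ≤ a`, so the natural-number subtraction is not truncated. -/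
theorem injective_mulVec_of_range_eq_ker {a b c : ℕ} {B : Matrix (Fin c) (Fin a) ℝ}
    {R : Matrix (Fin a) (Fin b) ℝ} (hB : Function.Surjective B.mulVec) (hb : b = a - c)
    (hR : LinearMap.range R.mulVecLin = LinearMap.ker B.mulVecLin) :
    Function.Injective R.mulVec := by
  have h1 := LinearMap.finrank_range_add_finrank_ker B.mulVecLin
  have h2 := LinearMap.finrank_range_add_finrank_ker R.mulVecLin
  have h3 : LinearMap.range B.mulVecLin = ⊤ := LinearMap.range_eq_top.mpr hB
  rw [h3, finrank_top, Module.finrank_fin_fun, Module.finrank_fin_fun, ← hR] at h1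
  rw [Module.finrank_fin_fun] at h2
  have h4 : Module.finrank ℝ (LinearMap.ker R.mulVecLin) = 0 := by omega
  have h5 : LinearMap.ker R.mulVecLin = ⊥ := Submodule.finrank_eq_zero.mp h4
  exact LinearMap.ker_eq_bot.mp h5

variable {idx : Fin (P.card456 x mu) → Fin J}
  {R : (i : ℕ) → Matrix (Fin (P.redDim x mu l idx i)) (Fin (P.redDim x mu l idx (i + 1))) ℝ}

/-- Each `R_i` cuts the range of the previous product down to the kernel of one more `𝒢_j`;
inductively the range of `P_i` is the intersection of the first `i` kernels. -/
theorem exists_prodMat_mulVec_iff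
    (hR : ∀ i : Fin (P.card456 x mu),
      LinearMap.range (R i).mulVecLin =
        LinearMap.ker (P.calG x mu H (idx i) * P.prodMat x mu R i).mulVecLin) {i : ℕ}
    (hi : i ≤ P.card456 x mu) (ν : Fin l → ℝ) :
    (∃ u, (P.prodMat x mu R i).mulVec u = ν) ↔
      ∀ k : Fin (P.card456 x mu), (k : ℕ) < i → (P.calG x mu H (idx k)).mulVec ν = 0 := by
  induction i generalizing ν with
  | zero =>
    refine ⟨fun _ k hk => absurd hk (Nat.not_lt_zero _), fun _ => ⟨ν, ?_⟩⟩
    exact Matrix.one_mulVec ν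
  | succ i ih =>
    have ih := fun ν => ih (by omega) ν
    have hRi : ∀ y, (∃ u, (R i).mulVec u = y) ↔
        (P.calG x mu H (idx ⟨i, hi⟩)).mulVec ((P.prodMat x mu R i).mulVec y) = 0 := by
      intro y
      have := SetLike.ext_iff.mp (hR ⟨i, hi⟩) y
      rw [LinearMap.mem_range, LinearMap.mem_ker, Matrix.mulVecLin_apply] at this
      rw [Matrix.mulVec_mulVec]
      exact this
    have hprod : ∀ u, (P.prodMat x mu R (i + 1)).mulVec u =
        (P.prodMat x mu R i).mulVec ((R i).mulVec u) := fun u => by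
      rw [Matrix.mulVec_mulVec]; rfl
    constructor
    · rintro ⟨u, rfl⟩ k hk
      rw [hprod]
      rcases Nat.lt_succ_iff_lt_or_eq.mp hk with h | h
      · exact (ih _).mp ⟨_, rfl⟩ k h
      · have hk' : k = ⟨i, hi⟩ := Fin.ext h
        rw [hk']
        exact (hRi _).mp ⟨u, rfl⟩
    · intro h
      obtain ⟨y, rfl⟩ := (ih ν).mpr fun k hk => h k (by omega)
      obtain ⟨u, rfl⟩ := (hRi y).mpr (h ⟨i, hi⟩ (Nat.lt_succ_self i))
      exact ⟨u, hprod u⟩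

/-- Joint surjectivity yields `ν` with the wanted value in block `i` and value `0` in all others;
such a `ν` lies in the range of the product preceding block `i`. -/
theorem surjective_calG_mul_prodMat (hmul : P.IsMultiplier x lam mu) (hnd : P.IsNondegenerate x)
    (hrange : LinearMap.range (Matrix.toEuclideanLin H) = P.affCritical x)
    (hidx : P.IsOrderedEnumeration x mu idx)
    (hR : ∀ i : Fin (P.card456 x mu),
      LinearMap.range (R i).mulVecLin =
        LinearMap.ker (P.calG x mu H (idx i) * P.prodMat x mu R i).mulVecLin)
    (i : Fin (P.card456 x mu)) :
    Function.Surjective (P.calG x mu H (idx i) * P.prodMat x mu R i).mulVec := by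
  intro c
  have hmem : ∀ k, idx k ∈ P.J4 x mu ∪ P.J5 x mu ∪ P.J6 x mu := fun k => by
    rw [← hidx.2.1]; exact ⟨k, rfl⟩
  obtain ⟨ν, h1, h2⟩ := exists_calG_mulVec_eq hmul hnd hrange (hmem i) c
  obtain ⟨u, rfl⟩ := (exists_prodMat_mulVec_iff hR i.2.le ν).mpr fun k hk =>
    h2 _ (hmem k) fun h => absurd (congrArg Fin.val (hidx.1 h)) (ne_of_lt hk)
  exact ⟨u, by rw [← Matrix.mulVec_mulVec, h1]⟩

theorem injective_prodMat_mulVec (hmul : P.IsMultiplier x lam mu) (hnd : P.IsNondegenerate x)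
    (hrange : LinearMap.range (Matrix.toEuclideanLin H) = P.affCritical x)
    (hidx : P.IsOrderedEnumeration x mu idx)
    (hR : ∀ i : Fin (P.card456 x mu),
      LinearMap.range (R i).mulVecLin =
        LinearMap.ker (P.calG x mu H (idx i) * P.prodMat x mu R i).mulVecLin) {i : ℕ}
    (hi : i ≤ P.card456 x mu) : Function.Injective (P.prodMat x mu R i).mulVec := by
  induction i with
  | zero =>
    intro u v h
    exact (Matrix.one_mulVec u).symm.trans (h.trans (Matrix.one_mulVec v))
  | succ i ih =>
    have hinj := injective_mulVec_of_range_eq_ker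
      (surjective_calG_mul_prodMat hmul hnd hrange hidx hR ⟨i, hi⟩)
      (by rw [redDim, dif_pos (show i < P.card456 x mu from hi)]) (hR ⟨i, hi⟩)
    intro u v h
    have hprod : ∀ u, (P.prodMat x mu R (i + 1)).mulVec u =
        (P.prodMat x mu R i).mulVec ((R i).mulVec u) := fun u => by
      rw [Matrix.mulVec_mulVec]; rfl
    change (P.prodMat x mu R (i + 1)).mulVec u = (P.prodMat x mu R (i + 1)).mulVec v at h
    rw [hprod, hprod] at h
    exact hinj (ih (by omega) h)

theorem posDef_redMat (hmul : P.IsMultiplier x lam mu) (hnd : P.IsNondegenerate x)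
    (hrange : LinearMap.range (Matrix.toEuclideanLin H) = P.affCritical x)
    (hpos : (H.transpose * P.Theta x mu lam * H).PosDef)
    (hidx : P.IsOrderedEnumeration x mu idx)
    (hR : ∀ i : Fin (P.card456 x mu),
      LinearMap.range (R i).mulVecLin =
        LinearMap.ker (P.calG x mu H (idx i) * P.prodMat x mu R i).mulVecLin) {i : ℕ}
    (hi : i ≤ P.card456 x mu) : (P.redMat x mu H lam R i).PosDef := by
  have h := hpos.conjTranspose_mul_mul_same
    (injective_prodMat_mulVec hmul hnd hrange hidx hR hi)
  rw [Matrix.conjTranspose_eq_transpose_of_trivial] at h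
  simpa only [redMat, Matrix.mul_assoc] using h

theorem injective_vecMul_of_surjective_mulVec {a b : ℕ} {B : Matrix (Fin a) (Fin b) ℝ}
    (hB : Function.Surjective B.mulVec) : Function.Injective fun v => Matrix.vecMul v B := by
  intro u v h
  refine dotProduct_eq _ _ fun w => ?_
  obtain ⟨z, rfl⟩ := hB w
  rw [Matrix.dotProduct_mulVec, Matrix.dotProduct_mulVec]
  exact congrArg (· ⬝ᵥ z) h

end Problem

end NSOCP

end

/-! ### Conclusion from positive definiteness and full row rank -/

theorem proposition4p7 {n m J : ℕ} {r : Fin J → ℕ} (P : NSOCP.Problem n m J r)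
    (x : EuclideanSpace ℝ (Fin n)) (lam : EuclideanSpace ℝ (Fin m))
    (mu : (j : Fin J) → EuclideanSpace ℝ (Fin (r j + 1)))
    (hopt : P.IsLocallyOptimal x) (hmul : P.IsMultiplier x lam mu) (hnd : P.IsNondegenerate x)
    {l : ℕ} (H : Matrix (Fin n) (Fin l) ℝ) (hrank : H.rank = l)
    (hrange : LinearMap.range (Matrix.toEuclideanLin H) = P.affCritical x)
    (hcod : P.ReducedCoderivativeCondition x mu H lam)
    (idx : Fin (P.card456 x mu) → Fin J) (hidx : P.IsOrderedEnumeration x mu idx)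
    (R : (i : ℕ) →
      Matrix (Fin (P.redDim x mu l idx i)) (Fin (P.redDim x mu l idx (i + 1))) ℝ)
    (hR : ∀ i : Fin (P.card456 x mu),
      LinearMap.range (R i).mulVecLin =
        LinearMap.ker (P.calG x mu H (idx i) * P.prodMat x mu R i).mulVecLin) :
    (∀ i ≤ P.card456 x mu, IsUnit (P.redMat x mu H lam R i)) ∧
      ∀ i : Fin (P.card456 x mu),
        ((P.calG x mu H (idx i) * P.prodMat x mu R i) * (P.redMat x mu H lam R i)⁻¹ *
          (P.calG x mu H (idx i) * P.prodMat x mu R i).transpose).PosDef := by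
  have hpos := NSOCP.Problem.posDef_reducedHessian hopt hmul hnd hrange hcod
  have hT := fun (i : ℕ) (hi : i ≤ P.card456 x mu) =>
    NSOCP.Problem.posDef_redMat hmul hnd hrange hpos hidx hR hi
  refine ⟨fun i hi => (hT i hi).isUnit, fun i => ?_⟩
  have h := (hT i i.2.le).inv.mul_mul_conjTranspose_same
    (NSOCP.Problem.injective_vecMul_of_surjective_mulVec
      (NSOCP.Problem.surjective_calG_mul_prodMat hmul hnd hrange hidx hR i))
  rwa [Matrix.conjTranspose_eq_transpose_of_trivial] at h
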